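/- Let $T$ be a complete first order theory in a language $L$, and assume that $T$ is dependent (no formula has the independence property). Put $\theta = |T|$, the number of sentences of $L$, i.e. $\theta=\max(\aleph_0,\text{number of symbols of }L)$. Let $\kappa$ be a singular cardinal with $\mathrm{cf}(\kappa) > |T|$, and let $M$ be a model of $T$ which is exactly $\kappa$-saturated, i.e. $\kappa$-saturated but not $\kappa^+$-saturated. For $A \subseteq M$ let $\mathbf S^\theta(A)$ be the set of complete types over $A$ in $\theta$ variables. A type $p(\bar x)$ over a set does not split over $N$ when $\varphi(\bar x,\bar b), \neg\varphi(\bar x,\bar c) \in p$ implies $\mathrm{tp}(\bar b,N) \neq \mathrm{tp}(\bar c,N)$. Then there are an elementary submodel $N \prec M$ of cardinality $<\kappa$ and a set $A \subseteq M$ of cardinality $\kappa$ such that: (a) there is $p \in \mathbf S^\theta(A)$ which is omitted by $M$ and does not split over $N$; (b) moreover, for this $p$ there is $q \in \mathbf S^\theta(M)$ which does not split over $N$ and satisfies $p = q \restriction A$; and there is an ultrafilter $\mathcal D$ on ${}^{\theta}N$ (the set of $\theta$-tuples of elements of $N$) such that $p = \mathrm{Av}(\mathcal D, A) = \{\varphi(\bar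 x,\bar b) : \bar b \text{ from } A,\ \{\bar c \in {}^\theta N : M \models \varphi[\bar c,\bar b]\} \in \mathcal D\}$; (c) there is a sequence $\langle \bar a_\alpha : \alpha<\kappa\rangle$ of $\theta$-tuples of elements of $M$, indiscernible over $N$, such that, with $B = N \cup \bigcup_{\alpha<\kappa}\mathrm{Rang}(\bar a_\alpha)$, the average type $\mathrm{Av}(\langle \bar a_\alpha : \alpha<\kappa\rangle, B) = \{\varphi(\bar x,\bar b) : \bar b \text{ from } B,\ M \models \varphi[\bar a_\alpha,\bar b] \text{ for all large enough } \alpha<\kappa\}$ is a complete type over $B$ and is omitted by $M$; equivalently (and also asserted), there is no $\bar a_\kappa \in {}^\theta M$ such that $\langle \bar a_\alpha : \alpha \le \kappa\rangle$ is indiscernible over $N$. -/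

import Mathlib

open Cardinal FirstOrder Filter

universe u v w x y

namespace SingularExactSaturation

/-- The cardinality `|T|` of a (complete) theory `T` in the language `L`, that is, the number of
sentences of `L`: the maximum of `ℵ₀` and the number of symbols of `L`. -/
noncomputable def theoryCard (L : FirstOrder.Language.{u, v}) : Cardinal.{max u v} :=
  max ℵ₀ L.card

/-- The formula `φ(x̄, ȳ)` has the independence property in the theory `T`: for every `n` there are,
in some model of `T`, parameters `b 0, …, b (n - 1)` such that every Boolean pattern of the
instances `φ(x̄, b i)` is realized. (For a complete theory the choice of the model, and of the
universe in which it lives, is immaterial.) -/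
def HasIndependenceProperty {L : FirstOrder.Language.{u, v}} (T : L.Theory) {k l : ℕ}
    (φ : L.Formula (Fin k ⊕ Fin l)) : Prop :=
  ∀ n : ℕ, ∃ (M : FirstOrder.Language.Theory.ModelType.{u, v, w} T) (b : Fin n → Fin l → M),
    ∀ s : Set (Fin n), ∃ a : Fin k → M, ∀ i : Fin n, φ.Realize (Sum.elim a (b i)) ↔ i ∈ s

/-- `T` is dependent (has NIP): no formula has the independence property. -/
def IsDependent {L : FirstOrder.Language.{u, v}} (T : L.Theory) : Prop :=
  ∀ (k l : ℕ) (φ : L.Formula (Fin k ⊕ Fin l)), ¬ HasIndependenceProperty.{u, v, w} T φ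

section Types

variable (L : FirstOrder.Language.{u, v}) {M : Type w} [L.Structure M]

/-- Formulas `φ(x̄, ā)` with variables `x̄ = ⟨x i : i ∈ ι⟩` and parameters `ā` from `A`. -/
abbrev ParamFormula (A : Set M) (ι : Type x) := L.Formula (A ⊕ ι)

variable {L}

/-- The tuple `c` of elements of `M` satisfies the formula `φ(x̄, ā)` in `M`. -/
def Sat {A : Set M} {ι : Type x} (φ : ParamFormula L A ι) (c : ι → M) : Prop :=
  φ.Realize (Sum.elim (fun a : A => (a : M)) c)

/-- The tuple `c` of elements of `M` realizes the set `p` of formulas over `A`. -/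
def Realizes {A : Set M} {ι : Type x} (p : Set (ParamFormula L A ι)) (c : ι → M) : Prop :=
  ∀ φ ∈ p, Sat φ c

/-- The model `M` omits the set `p` of formulas over `A ⊆ M`. -/
def Omits {A : Set M} {ι : Type x} (p : Set (ParamFormula L A ι)) : Prop :=
  ¬ ∃ c : ι → M, Realizes p c

variable (L)

/-- `S^ι(A)`: the complete types over `A ⊆ M` in the variables `⟨x i : i ∈ ι⟩`, that is, the
complete sets of formulas over `A` which are finitely satisfiable in `M`. -/
def completeTypes (A : Set M) (ι : Type x) : Set (Set (ParamFormula L A ι)) :=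
  {p | (∀ s : Finset (ParamFormula L A ι), ↑s ⊆ p → ∃ c : ι → M, ∀ φ ∈ s, Sat φ c) ∧
    ∀ φ : ParamFormula L A ι, φ ∈ p ∨ φ.not ∈ p}

/-- `tp(c, A)`: the complete type over `A` of a tuple `c` of elements of `M`. -/
def tp (A : Set M) {ι : Type x} (c : ι → M) : Set (ParamFormula L A ι) :=
  {φ | Sat φ c}

variable {L}

/-- The restriction `q ↾ A` of a type `q` over `B ⊇ A`. -/
def restrict {A B : Set M} (h : A ⊆ B) {ι : Type x} (q : Set (ParamFormula L B ι)) :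
    Set (ParamFormula L A ι) :=
  {φ | φ.relabel (Sum.map (Set.inclusion h) id) ∈ q}

/-- The formula `φ(x̄, b̄)` over `A` obtained from `φ(x̄, ȳ)` by substituting `b̄` for `ȳ`. -/
def inst {A : Set M} {ι : Type x} {n : ℕ} (φ : L.Formula (Fin n ⊕ ι)) (b : Fin n → A) :
    ParamFormula L A ι :=
  φ.relabel (Sum.map b id)

/-- The type `p(x̄)` over `B` does not split over `A`: if `φ(x̄, b̄)` and `¬ φ(x̄, c̄)` belong to
`p`, then `tp(b̄, A) ≠ tp(c̄, A)`. -/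
def DoesNotSplitOver {B : Set M} {ι : Type x} (p : Set (ParamFormula L B ι)) (A : Set M) : Prop :=
  ∀ (n : ℕ) (φ : L.Formula (Fin n ⊕ ι)) (b c : Fin n → B),
    inst φ b ∈ p → (inst φ c).not ∈ p →
      tp L A (fun i => (b i : M)) ≠ tp L A (fun i => (c i : M))

variable (L M)

/-- `M` is `κ`-saturated: every complete 1-type over a subset of `M` of cardinality less than `κ`
is realized in `M`. -/
def IsSaturated (κ : Cardinal.{w}) : Prop :=
  ∀ A : Set M, #A < κ → ∀ p ∈ completeTypes L A (Fin 1), ∃ c : Fin 1 → M, Realizes p c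

/-- `M` is exactly `κ`-saturated: it is `κ`-saturated but not `κ⁺`-saturated. -/
def IsExactlySaturated (κ : Cardinal.{w}) : Prop :=
  IsSaturated L M κ ∧ ¬ IsSaturated L M (Order.succ κ)

variable {M}

/-- The sequence `⟨a t : t ∈ I⟩` of `ι`-tuples is indiscernible over `A`: for all
`s 0 < ⋯ < s (n - 1)` and `t 0 < ⋯ < t (n - 1)` in `I` the concatenations of the `a (s j)` and of
the `a (t j)` realize the same type over `A`. -/
def IsIndiscernible (A : Set M) {I : Type y} [LinearOrder I] {ι : Type x} (a : I → ι → M) :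
    Prop :=
  ∀ (n : ℕ) (s t : Fin n → I), StrictMono s → StrictMono t →
    tp L A (fun j : Fin n × ι => a (s j.1) j.2) = tp L A (fun j : Fin n × ι => a (t j.1) j.2)

/-- `Av(⟨a t : t ∈ I⟩ / F, A)`: the formulas over `A` that are satisfied by `a t` for `F`-almost all
`t ∈ I`. For a sequence without a given filter, `F` is the filter `atTop` of co-bounded sets. -/
def average {I : Type y} {ι : Type x} (a : I → ι → M) (F : Filter I) (A : Set M) :
    Set (ParamFormula L A ι) :=
  {φ | ∀ᶠ t in F, Sat φ (a t)}

end Types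

end SingularExactSaturation

open SingularExactSaturation

-- The heart of the matter is that some type finitely satisfiable in a small set is omitted over a
-- set of size `κ`. Suppose not, i.e. `RealizesCoheirs`; then `M` would be `κ⁺`-saturated, as
-- follows.
--
-- Fix a finitely satisfiable family `Γ` of at most `κ` conditions and a formula `φ`. Adjoin to a
-- realization `x` of `Γ` pairs of tuples `b`, `b'` with `φ(x, b)` and `¬ φ(x, b')`, where the two
-- members of a pair have the same type in the sense of `Alternates.symm` and all of them are
-- finitely satisfiable in a small set. By symmetry, `k` pairs give a shattered set of size `k`, so
-- dependence bounds `k`. When no further pair can be adjoined, each small set of instances of `φ`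
-- is implied by one condition `T(x, y)`, with `y` the tuple of pairs. Since `κ` is singular, fewer
-- than `κ` such conditions cover all instances; realizing the type of `y` by some `c`, which
-- `RealizesCoheirs` allows, turns them into a small set of conditions `T(x, c)` consistent with `Γ`
-- (`exists_small_implying`). Doing this for all formulas, of which there are fewer than `cf κ`,
-- replaces a type over a set of size `κ` by a small one, and `κ`-saturation realizes it.
--
-- So there is an omitted coheir, the average of an ultrafilter `D` on tuples of a small `N`; being
-- a coheir, it does not split over `N`. For (c), build a Morley sequence of `D` of length `κ`,
-- giving every formula each truth value cofinally often when possible. If `c` realizes the average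
-- over the sequence but not over `A`, some formula alternates cofinally along an indiscernible
-- sequence, against dependence (`exists_isMorley_omits`).

universe z

namespace SingularExactSaturation

/-! ### Definable sets of tuples in arbitrarily many variables. -/

section Definability

variable {L : FirstOrder.Language.{u, v}} {M : Type w} [L.Structure M]

theorem exists_finset_realize_congr {α : Type*} (φ : L.Formula α) :
    ∃ F : Finset α, ∀ v v' : α → M, (∀ a ∈ F, v a = v' a) → (φ.Realize v ↔ φ.Realize v') := by
  classical
  refine ⟨φ.freeVarFinset, fun v v' h => ?_⟩
  have h1 := FirstOrder.Language.BoundedFormula.realize_restrictFreeVar (φ := φ)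
    (f := fun a => (a : α)) (v := v) (xs := (default : Fin 0 → M)) v (fun _ => rfl)
  have h2 := FirstOrder.Language.BoundedFormula.realize_restrictFreeVar (φ := φ)
    (f := fun a => (a : α)) (v := v) (xs := (default : Fin 0 → M)) v' (fun a => h a a.2)
  exact h1.symm.trans h2

/-- Only finitely many variables occur in `φ`, so a quantifier over an infinite tuple is a finite
block of quantifiers; the other coordinates are filled arbitrarily. -/
theorem exists_formula_realize_iff_exists [Nonempty M] {α β : Type*} (φ : L.Formula (α ⊕ β)) :
    ∃ χ : L.Formula α, ∀ v : α → M, χ.Realize v ↔ ∃ x : β → M, φ.Realize (Sum.elim v x) := by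
  classical
  let f : φ.freeVarFinset → α ⊕ {b : β // Sum.inr b ∈ φ.freeVarFinset} := fun a =>
    match a with
    | ⟨Sum.inl a, _⟩ => Sum.inl a
    | ⟨Sum.inr b, h⟩ => Sum.inr ⟨b, h⟩
  have : Finite {b : β // Sum.inr b ∈ φ.freeVarFinset} :=
    Finite.of_injective (β := φ.freeVarFinset) (fun b => ⟨Sum.inr b.1, b.2⟩) (by
      intro a b h; simpa [Subtype.ext_iff] using h)
  let ψ : L.Formula (α ⊕ {b : β // Sum.inr b ∈ φ.freeVarFinset}) := φ.restrictFreeVar f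
  have key : ∀ (v : α → M) (x : β → M),
      ψ.Realize (Sum.elim v (fun b => x b.1)) ↔ φ.Realize (Sum.elim v x) := fun v x =>
    FirstOrder.Language.BoundedFormula.realize_restrictFreeVar _ (by
      rintro ⟨a | b, h⟩ <;> rfl)
  refine ⟨ψ.iExs _, fun v => ?_⟩
  rw [FirstOrder.Language.Formula.realize_iExs]
  constructor
  · rintro ⟨i, hi⟩
    let m : M := Classical.arbitrary M
    refine ⟨fun b => if h : Sum.inr b ∈ φ.freeVarFinset then i ⟨b, h⟩ else m, ?_⟩
    rw [← key]
    convert hi using 3 with b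
    exact dif_pos b.2
  · rintro ⟨x, hx⟩
    exact ⟨_, (key v x).2 hx⟩

theorem definable_iff_sat {A : Set M} {ι : Type x} {S : Set (ι → M)} :
    A.Definable L S ↔ ∃ φ : ParamFormula L A ι, S = {c | Sat φ c} :=
  Set.definable_iff_exists_formula_sum

theorem definable_sat {A : Set M} {ι : Type x} (φ : ParamFormula L A ι) :
    A.Definable L {c : ι → M | Sat φ c} :=
  definable_iff_sat.2 ⟨φ, rfl⟩

theorem definable_of_realize {A : Set M} {α ι : Type*} (φ : L.Formula α) (g : α → A ⊕ ι)
    {S : Set (ι → M)}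
    (hS : ∀ c, c ∈ S ↔ φ.Realize fun a => Sum.elim (fun b : A => (b : M)) c (g a)) :
    A.Definable L S := by
  refine definable_iff_sat.2 ⟨φ.relabel g, Set.ext fun c => ?_⟩
  rw [hS]
  simp only [Sat, Set.mem_ofPred_eq, FirstOrder.Language.Formula.realize_relabel]
  rfl

theorem definable_preimage {ι : Type x} {ι' : Type y} {A : Set M} {f : (ι' → M) → ι → M}
    (hf : ∀ i, (∃ m ∈ A, ∀ c, f c i = m) ∨ ∃ j, ∀ c, f c i = c j) {S : Set (ι → M)}
    (hS : A.Definable L S) : A.Definable L (f ⁻¹' S) := by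
  obtain ⟨φ, rfl⟩ := definable_iff_sat.1 hS
  have : ∀ i, ∃ g : A ⊕ ι', ∀ c, f c i = Sum.elim (fun b : A => (b : M)) c g := by
    intro i
    rcases hf i with ⟨m, hm, h⟩ | ⟨j, h⟩
    · exact ⟨Sum.inl ⟨m, hm⟩, h⟩
    · exact ⟨Sum.inr j, h⟩
  choose g hg using this
  refine definable_of_realize φ (Sum.elim Sum.inl g) fun c => ?_
  simp only [Sat, Set.mem_preimage, Set.mem_ofPred_eq]
  refine iff_of_eq (congrArg _ (funext ?_))
  rintro (a | i)
  · rfl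
  · exact hg i c

theorem definable_exists [Nonempty M] {ι : Type x} {ξ : Type y} {A : Set M}
    {S : Set (ι ⊕ ξ → M)} (hS : A.Definable L S) :
    A.Definable L {c : ι → M | ∃ x : ξ → M, Sum.elim c x ∈ S} := by
  obtain ⟨φ, rfl⟩ := definable_iff_sat.1 hS
  obtain ⟨χ, hχ⟩ := exists_formula_realize_iff_exists (M := M)
    (φ.relabel (Equiv.sumAssoc A ι ξ).symm)
  refine definable_iff_sat.2 ⟨χ, Set.ext fun c => ?_⟩
  simp only [Sat, Set.mem_ofPred_eq, hχ, FirstOrder.Language.Formula.realize_relabel]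
  refine exists_congr fun x => iff_of_eq (congrArg _ (funext ?_))
  rintro (a | i | j) <;> rfl

theorem definable_forall [Nonempty M] {ι : Type x} {ξ : Type y} {A : Set M}
    {S : Set (ι ⊕ ξ → M)} (hS : A.Definable L S) :
    A.Definable L {c : ι → M | ∀ x : ξ → M, Sum.elim c x ∈ S} := by
  have := (definable_exists hS.compl).compl
  convert this using 1
  ext c; simp

theorem definable_biInter {ι : Type x} {A : Set M} {J : Type*} {s : Set J} (hs : s.Finite)
    {f : J → Set (ι → M)} (hf : ∀ j ∈ s, A.Definable L (f j)) :
    A.Definable L (⋂ j ∈ s, f j) := by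
  induction s, hs using Set.Finite.induction_on with
  | empty => simp
  | insert _ _ ih =>
    rw [Set.biInter_insert]
    exact (hf _ (Set.mem_insert _ _)).inter (ih fun j hj => hf j (Set.mem_insert_of_mem _ hj))

theorem definable_realize {α ι : Type*} (φ : L.Formula α) {f : (ι → M) → α → M}
    (hf : ∀ a, (∃ m, ∀ c, f c a = m) ∨ ∃ j, ∀ c, f c a = c j) :
    (Set.univ : Set M).Definable L {c : ι → M | φ.Realize (f c)} := by
  have : (Set.univ : Set M).Definable L {c : α → M | φ.Realize c} :=
    definable_of_realize φ Sum.inr fun c => Iff.rfl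
  exact definable_preimage (f := f) (fun i => (hf i).imp (fun ⟨m, h⟩ => ⟨m, trivial, h⟩) id) this

end Definability

/-! ### Dependence for formulas in infinite tuples of variables. -/

section Independence

variable {L : FirstOrder.Language.{u, v}} {T : L.Theory} {M : Type w} [L.Structure M]
  [Nonempty M] [M ⊨ T]

/-- In a model of a dependent theory no formula, in any tuples of variables, shatters arbitrarily
large finite sets. -/
theorem IsDependent.exists_not_shattered (hT : IsDependent.{u, v, w} T) {ξ ζ : Type*}
    (φ : L.Formula (ξ ⊕ ζ)) :
    ∃ n : ℕ, ∀ b : Fin n → ζ → M, ∃ s : Set (Fin n), ∀ a : ξ → M,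
      ¬ ∀ i, φ.Realize (Sum.elim a (b i)) ↔ i ∈ s := by
  classical
  obtain ⟨F, hF⟩ := exists_finset_realize_congr (M := M) φ
  let eξ := F.toLeft.equivFin
  let eζ := F.toRight.equivFin
  -- The extra index `Fin.last` is a dummy that absorbs all variables outside the finite support
  -- `F`.
  let g : ξ ⊕ ζ → Fin (F.toLeft.card + 1) ⊕ Fin (F.toRight.card + 1) := Sum.map
    (fun a => if h : a ∈ F.toLeft then (eξ ⟨a, h⟩).castSucc else Fin.last _)
    (fun a => if h : a ∈ F.toRight then (eζ ⟨a, h⟩).castSucc else Fin.last _)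
  have hn := hT _ _ (φ.relabel g)
  simp only [HasIndependenceProperty, not_forall, not_exists] at hn
  obtain ⟨n, hn⟩ := hn
  refine ⟨n, fun b => ?_⟩
  let m : M := Classical.arbitrary M
  obtain ⟨s, hs⟩ := hn (FirstOrder.Language.Theory.ModelType.of T M)
    (fun i j => if h : (j : ℕ) < F.toRight.card then b i (eζ.symm ⟨j, h⟩) else m)
  refine ⟨s, fun a ha => ?_⟩
  obtain ⟨i, hi⟩ := hs (fun j => if h : (j : ℕ) < F.toLeft.card then a (eξ.symm ⟨j, h⟩) else m)
  refine hi (Iff.trans ?_ (ha i))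
  rw [FirstOrder.Language.Formula.realize_relabel]
  refine hF _ _ ?_
  rintro (c | c) hc
  · simp [g, hc]
  · simp [g, hc]

end Independence

/-! ### Transfinite recursion, and saturation in fewer than `κ` variables. -/

/-- Construction by well-founded recursion of a sequence whose terms satisfy a relation to the
earlier ones. -/
theorem exists_forall_rel_of_wellFounded {ι : Type x} {X : Type y} [LinearOrder ι]
    [WellFoundedLT ι] [Nonempty X] (R : ι → (ι → X) → X → Prop)
    (hR : ∀ t c c' m, (∀ s < t, c s = c' s) → R t c m → R t c' m)
    (h : ∀ t c, (∀ s < t, R s c (c s)) → ∃ m, R t c m) : ∃ c : ι → X, ∀ t, R t c (c t) := by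
  classical
  let x0 : X := Classical.arbitrary X
  let ext : (t : ι) → ((s : ι) → s < t → X) → ι → X := fun t ih s =>
    if hs : s < t then ih s hs else x0
  let F : (t : ι) → ((s : ι) → s < t → X) → X := fun t ih =>
    if hm : ∃ m, R t (ext t ih) m then hm.choose else x0
  let c : ι → X := (wellFounded_lt (α := ι)).fix F
  have hc : ∀ t, c t = F t fun s _ => c s := fun t => WellFounded.fix_eq _ F t
  have hext : ∀ t, ∀ s < t, ext t (fun s _ => c s) s = c s := fun t s hs => by simp [ext, hs]
  refine ⟨c, fun t => ?_⟩
  induction t using (wellFounded_lt (α := ι)).induction with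
  | _ t ih =>
    obtain ⟨m, hm⟩ := h t c ih
    have hex : ∃ m, R t (ext t fun s _ => c s) m :=
      ⟨m, hR _ _ _ _ (fun s hs => (hext t s hs).symm) hm⟩
    refine hR _ _ _ _ (hext t) ?_
    rw [hc t]
    simp only [F, dif_pos hex]
    exact hex.choose_spec

section Saturation

variable {L : FirstOrder.Language.{u, v}} {M : Type w} [L.Structure M]

theorem sat_not {A : Set M} {ι : Type x} (φ : ParamFormula L A ι) (c : ι → M) :
    Sat φ.not c ↔ ¬ Sat φ c :=
  FirstOrder.Language.Formula.realize_not

theorem sat_inf {A : Set M} {ι : Type x} (φ ψ : ParamFormula L A ι) (c : ι → M) :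
    Sat (φ ⊓ ψ) c ↔ Sat φ c ∧ Sat ψ c :=
  FirstOrder.Language.Formula.realize_inf

/-- The average of a family of tuples along an ultrafilter is a complete type. -/
theorem average_mem_completeTypes {I : Type y} {ι : Type x} (a : I → ι → M) (D : Ultrafilter I)
    (A : Set M) : average L a (D : Filter I) A ∈ completeTypes L A ι := by
  refine ⟨fun s hs => ?_, fun φ => ?_⟩
  · have : ∀ᶠ t in (D : Filter I), ∀ φ ∈ s, Sat φ (a t) :=
      (Filter.eventually_all_finset s).2 fun φ hφ => hs hφ
    obtain ⟨t, ht⟩ := this.exists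
    exact ⟨a t, ht⟩
  · rcases Ultrafilter.em D (fun t => Sat φ (a t)) with h | h
    · exact Or.inl h
    · exact Or.inr (h.mono fun t ht => (sat_not _ _).2 ht)

theorem IsSaturated.exists_sat_one {κ : Cardinal.{w}} (hM : IsSaturated L M κ) {A : Set M}
    (hA : #A < κ) (F : Filter (Fin 1 → M)) [F.NeBot] :
    ∃ c : Fin 1 → M, ∀ χ : ParamFormula L A (Fin 1), (∀ᶠ x in F, Sat χ x) → Sat χ c := by
  obtain ⟨c, hc⟩ := hM A hA _ (average_mem_completeTypes id (Ultrafilter.of F) A)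
  exact ⟨c, fun χ hχ => hc χ (Ultrafilter.of_le F hχ)⟩

/-- A `κ`-saturated structure realizes the types over small sets in fewer than `κ` variables. -/
theorem IsSaturated.exists_sat [Nonempty M] {κ : Cardinal.{w}} (hκ : ℵ₀ ≤ κ)
    (hM : IsSaturated L M κ) {A : Set M} (hA : #A < κ) {ι : Type x}
    (hι : Cardinal.lift.{w} #ι < Cardinal.lift.{x} κ) (F : Filter (ι → M)) [F.NeBot] :
    ∃ c : ι → M, ∀ χ : ParamFormula L A ι, (∀ᶠ x in F, Sat χ x) → Sat χ c := by
  classical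
  obtain ⟨_, _⟩ := exists_wellFoundedLT ι
  have glue : ∀ (t : Set ι) (c : ι → M), (∀ G : Finset ι, (∀ s ∈ G, s ∈ t) →
      ∀ χ : ParamFormula L A ι, (∀ᶠ x in F, Sat χ x) → ∃ x, Sat χ x ∧ ∀ s ∈ G, x s = c s) →
      ∀ χ : ParamFormula L A ι, (∀ᶠ x in F, Sat χ x) → ∃ x, Sat χ x ∧ ∀ s ∈ t, x s = c s := by
    intro t c h χ hχ
    obtain ⟨G, hG⟩ := exists_finset_realize_congr (M := M) χ
    obtain ⟨x, hx, hxc⟩ := h (G.toRight.filter (· ∈ t)) (by simp) χ hχ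
    refine ⟨fun s => if s ∈ t then c s else x s, ?_, fun s hs => by simp [hs]⟩
    refine (hG _ _ ?_).1 hx
    rintro (a | s) hs
    · rfl
    · by_cases hst : s ∈ t
      · simpa [hst] using hxc s (by simp [hs, hst])
      · simp [hst]
  have glue' : ∀ (t : Set ι) (c : ι → M), (∀ s ∈ t, ∀ χ : ParamFormula L A ι,
      (∀ᶠ x in F, Sat χ x) → ∃ x, Sat χ x ∧ (∀ s' < s, x s' = c s') ∧ x s = c s) →
      ∀ χ : ParamFormula L A ι, (∀ᶠ x in F, Sat χ x) → ∃ x, Sat χ x ∧ ∀ s ∈ t, x s = c s := by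
    intro t c h
    refine glue t c fun G hG χ hχ => ?_
    rcases G.eq_empty_or_nonempty with rfl | hne
    · obtain ⟨x, hx⟩ := hχ.exists
      exact ⟨x, hx, by simp⟩
    · obtain ⟨x, hx, h1, h2⟩ := h _ (hG _ (G.max'_mem hne)) χ hχ
      refine ⟨x, hx, fun s hs => ?_⟩
      rcases (G.le_max' s hs).lt_or_eq with h | h
      · exact h1 s h
      · rw [h]; exact h2
  -- Invariant of the recursion on variables: each formula that holds `F`-almost everywhere has a
  -- solution agreeing with `c` up to and including `t`. It passes to limits by `glue`, as a formula
  -- sees finitely many variables.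
  obtain ⟨c, hc⟩ := exists_forall_rel_of_wellFounded
    (fun (t : ι) (c : ι → M) (m : M) => ∀ χ : ParamFormula L A ι, (∀ᶠ x in F, Sat χ x) →
      ∃ x, Sat χ x ∧ (∀ s < t, x s = c s) ∧ x t = m)
    (fun t c c' m hcc h χ hχ => by
      obtain ⟨x, hx, h1, h2⟩ := h χ hχ
      exact ⟨x, hx, fun s hs => (h1 s hs).trans (hcc s hs), h2⟩)
    (fun t c h => by
      have hcl := glue' (Set.Iio t) c h
      let A' : Set M := A ∪ c '' Set.Iio t
      have hA' : #A' < κ := by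
        refine (mk_union_le _ _).trans_lt (add_lt_of_lt hκ hA ?_)
        rw [← Cardinal.lift_lt.{w, x}]
        exact (mk_image_le_lift.trans (lift_le.2 (mk_set_le _))).trans_lt hι
      let E : (χ : ParamFormula L A ι) → Set (ι → M) := fun χ =>
        {x | Sat χ x ∧ ∀ s < t, x s = c s}
      let F' : Filter (ι → M) :=
        { sets := {S | ∃ χ : ParamFormula L A ι, (∀ᶠ x in F, Sat χ x) ∧ E χ ⊆ S}
          univ_sets := by
            obtain ⟨χ, hχ⟩ : ∃ χ : ParamFormula L A ι, ∀ᶠ x in F, Sat χ x :=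
              ⟨⊤, by simp [Sat]⟩
            exact ⟨χ, hχ, Set.subset_univ _⟩
          sets_of_superset := fun ⟨χ, h1, h2⟩ h => ⟨χ, h1, h2.trans h⟩
          inter_sets := by
            rintro S S' ⟨χ, h1, h2⟩ ⟨χ', h1', h2'⟩
            refine ⟨χ ⊓ χ', (h1.and h1').mono fun x hx => (sat_inf _ _ _).2 hx, ?_⟩
            rintro x ⟨hx, hx'⟩
            rw [sat_inf] at hx
            exact ⟨h2 ⟨hx.1, hx'⟩, h2' ⟨hx.2, hx'⟩⟩ }
      have : F'.NeBot := by
        refine Filter.neBot_iff.2 fun hbot => ?_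
        have : (∅ : Set (ι → M)) ∈ F' := by rw [hbot]; trivial
        obtain ⟨χ, h1, h2⟩ := this
        obtain ⟨x, hx, hxc⟩ := hcl χ h1
        exact h2 (show x ∈ E χ from ⟨hx, hxc⟩)
      obtain ⟨m, hm⟩ := hM.exists_sat_one hA' (F'.map fun x _ => x t)
      refine ⟨m 0, fun χ hχ => ?_⟩
      -- Below `t` the chosen values become parameters, at `t` stands the free variable, and the
      -- remaining coordinates are quantified existentially.
      let f : (Fin 1 ⊕ ι → M) → ι → M := fun z s =>
        if s < t then c s else if s = t then z (Sum.inl 0) else z (Sum.inr s)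
      have hdef : A'.Definable L (f ⁻¹' {x | Sat χ x}) := by
        refine definable_preimage (fun s => ?_) ((definable_sat χ).mono Set.subset_union_left)
        by_cases hs : s < t
        · exact Or.inl ⟨c s, Or.inr ⟨s, hs, rfl⟩, fun z => by simp [f, hs]⟩
        · by_cases hst : s = t
          · exact Or.inr ⟨Sum.inl 0, fun z => by simp [f, hst]⟩
          · exact Or.inr ⟨Sum.inr s, fun z => by simp [f, hs, hst]⟩
      obtain ⟨χ', hχ'⟩ := definable_iff_sat.1 (definable_exists hdef)
      have hev : ∀ᶠ x in F', Sat χ' (fun _ : Fin 1 => x t) := by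
        refine ⟨χ, hχ, ?_⟩
        rintro x ⟨hx, hxc⟩
        have : (fun _ : Fin 1 => x t) ∈ {c | Sat χ' c} := by
          rw [← hχ']
          refine ⟨x, ?_⟩
          convert hx using 1
          have : f (Sum.elim (fun _ : Fin 1 => x t) x) = x := by
            funext s
            by_cases hs : s < t
            · simp [f, hs, hxc s hs]
            · by_cases hst : s = t
              · simp [f, hst]
              · simp [f, hs, hst]
          exact iff_of_eq (congrArg (Sat χ) this)
        exact this
      have hmem : m ∈ {c | Sat χ' c} := hm χ' hev
      rw [← hχ'] at hmem
      obtain ⟨x, hx⟩ := hmem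
      refine ⟨f (Sum.elim m x), hx, fun s hs => by simp [f, hs], by simp [f]⟩)
  refine ⟨c, fun χ hχ => ?_⟩
  obtain ⟨x, hx, hxc⟩ := glue' Set.univ c (fun s _ => hc s) χ hχ
  rwa [show x = c from funext fun s => hxc s trivial] at hx

end Saturation

/-! ### Alternating pairs of tuples, bounded by dependence. -/

section Alternation

variable {L : FirstOrder.Language.{u, v}} {M : Type w} [L.Structure M]

/-- Variables for a sequence, indexed by `ℕ`, of pairs of `ℕ`-tuples. -/
abbrev BlockVar := ℕ × Bool × ℕ

/-- The tuple of values of `v` at the block `(j, e)`. -/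
def block {ξ : Type x} (v : ξ ⊕ BlockVar → M) (j : ℕ) (e : Bool) : ℕ → M :=
  fun i => v (Sum.inr (j, e, i))

/-- The type of `W` extends `Γ`; the instances of `φ` at the first `k` pairs of blocks alternate;
the type of all the blocks is finitely satisfiable in `N`; and the type of a choice of one block
from each pair does not depend on the choice. -/
structure Alternates {ξ : Type x} (φ : L.Formula (ξ ⊕ ℕ)) (Γ : Set (Set (ξ → M))) (N : Set M)
    (k : ℕ) (W : Ultrafilter (ξ ⊕ BlockVar → M)) : Prop where
  mem : ∀ S ∈ Γ, ∀ᶠ (v : ξ ⊕ BlockVar → M) in W, v ∘ Sum.inl ∈ S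
  alt : ∀ j < k, ∀ᶠ (v : ξ ⊕ BlockVar → M) in W, φ.Realize (Sum.elim (v ∘ Sum.inl) (block v j true)) ∧
    ¬ φ.Realize (Sum.elim (v ∘ Sum.inl) (block v j false))
  finsat : ∀ S : Set (BlockVar → M), (Set.univ : Set M).Definable L S →
    (∀ᶠ (v : ξ ⊕ BlockVar → M) in W, v ∘ Sum.inr ∈ S) → ∃ y ∈ S, ∀ i, y i ∈ N
  symm : ∀ (η η' : ℕ → Bool) (S : Set (ℕ × ℕ → M)), (Set.univ : Set M).Definable L S →
    (∀ᶠ (v : ξ ⊕ BlockVar → M) in W, (fun p : ℕ × ℕ => block v p.1 (η p.1) p.2) ∈ S) →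
    ∀ᶠ (v : ξ ⊕ BlockVar → M) in W, (fun p : ℕ × ℕ => block v p.1 (η' p.1) p.2) ∈ S

theorem exists_alternates_zero [Nonempty M] {ξ : Type x} (φ : L.Formula (ξ ⊕ ℕ))
    (Γ : Set (Set (ξ → M))) [hΓ : (Filter.generate Γ).NeBot] (m : M) :
    ∃ W, Alternates φ Γ {m} 0 W := by
  refine ⟨(Ultrafilter.of (Filter.generate Γ)).map fun x => Sum.elim x fun _ => m, ?_, ?_, ?_, ?_⟩
  · intro S hS
    exact Ultrafilter.of_le (Filter.generate Γ) (Filter.mem_generate_of_mem hS)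
  · intro j hj; omega
  · intro S _ h
    obtain ⟨x, hx⟩ := (show ∀ᶠ (x : ξ → M) in Ultrafilter.of (Filter.generate Γ),
      (Sum.elim x fun _ : BlockVar => m) ∘ Sum.inr ∈ S from h).exists
    exact ⟨_, hx, fun i => rfl⟩
  · intro η η' S _ h
    exact h

/-- Overwrites the pair of blocks with index `k`. -/
def updateBlocks {ξ : Type x} (k : ℕ) (v : ξ ⊕ BlockVar → M) (z z' : ℕ → M) :
    ξ ⊕ BlockVar → M :=
  Sum.elim (v ∘ Sum.inl) fun q =>
    if q.1 = k then (if q.2.1 then z' q.2.2 else z q.2.2) else v (Sum.inr q)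

theorem block_updateBlocks_of_ne {ξ : Type x} {k j : ℕ} (h : j ≠ k) (v : ξ ⊕ BlockVar → M)
    (z z' : ℕ → M) (e : Bool) : block (updateBlocks k v z z') j e = block v j e := by
  funext i; simp [block, updateBlocks, h]

theorem block_updateBlocks_true {ξ : Type x} (k : ℕ) (v : ξ ⊕ BlockVar → M) (z z' : ℕ → M) :
    block (updateBlocks k v z z') k true = z' := by
  funext i; simp [block, updateBlocks]

theorem block_updateBlocks_false {ξ : Type x} (k : ℕ) (v : ξ ⊕ BlockVar → M) (z z' : ℕ → M) :
    block (updateBlocks k v z z') k false = z := by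
  funext i; simp [block, updateBlocks]

/-- A filter of tuples of parameters from `C` which, for each definable set in `W`, are
almost all unable to decide `φ` positively from it. -/
theorem exists_ultrafilter_not_implied [Nonempty M] {ξ : Type x} (φ : L.Formula (ξ ⊕ ℕ))
    (W : Ultrafilter (ξ ⊕ BlockVar → M)) (C : Set (ℕ → M))
    (h : ∀ T : Set (ξ ⊕ BlockVar → M), (Set.univ : Set M).Definable L T → T ∈ W →
      ∃ b ∈ C, ∀ᶠ (v : ξ ⊕ BlockVar → M) in W, ∃ x, Sum.elim x (v ∘ Sum.inr) ∈ T ∧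
        ¬ φ.Realize (Sum.elim x b)) :
    ∃ U : Ultrafilter (ℕ → M), C ∈ U ∧
      ∀ T : Set (ξ ⊕ BlockVar → M), (Set.univ : Set M).Definable L T → T ∈ W →
        ∀ᶠ (b : ℕ → M) in U, ∀ᶠ (v : ξ ⊕ BlockVar → M) in W, ∃ x, Sum.elim x (v ∘ Sum.inr) ∈ T ∧
          ¬ φ.Realize (Sum.elim x b) := by
  let R : Set (ξ ⊕ BlockVar → M) → Set (ℕ → M) := fun T =>
    {b | b ∈ C ∧ ∀ᶠ (v : ξ ⊕ BlockVar → M) in W, ∃ x, Sum.elim x (v ∘ Sum.inr) ∈ T ∧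
      ¬ φ.Realize (Sum.elim x b)}
  let F : Filter (ℕ → M) :=
    { sets := {s | ∃ T, (Set.univ : Set M).Definable L T ∧ T ∈ W ∧ R T ⊆ s}
      univ_sets := ⟨Set.univ, Set.definable_univ, Filter.univ_mem, Set.subset_univ _⟩
      sets_of_superset := fun ⟨T, h1, h2, h3⟩ h => ⟨T, h1, h2, h3.trans h⟩
      inter_sets := by
        rintro s s' ⟨T, h1, h2, h3⟩ ⟨T', h1', h2', h3'⟩
        refine ⟨T ∩ T', h1.inter h1', Filter.inter_mem h2 h2', fun b hb => ⟨h3 ⟨hb.1, ?_⟩,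
          h3' ⟨hb.1, ?_⟩⟩⟩
        · exact hb.2.mono fun v ⟨x, hx, hn⟩ => ⟨x, hx.1, hn⟩
        · exact hb.2.mono fun v ⟨x, hx, hn⟩ => ⟨x, hx.2, hn⟩ }
  have : F.NeBot := by
    refine Filter.neBot_iff.2 fun hbot => ?_
    have : (∅ : Set (ℕ → M)) ∈ F := by rw [hbot]; trivial
    obtain ⟨T, h1, h2, h3⟩ := this
    obtain ⟨b, hb, hb'⟩ := h T h1 h2
    exact h3 (show b ∈ R T from ⟨hb, hb'⟩)
  refine ⟨Ultrafilter.of F, Ultrafilter.of_le F ?_, fun T h1 h2 => Ultrafilter.of_le F ?_⟩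
  · exact ⟨Set.univ, Set.definable_univ, Filter.univ_mem, fun b hb => hb.1⟩
  · exact ⟨T, h1, h2, fun b hb => hb.2⟩

/-- Amalgamation of the type of `W`, the product of its restriction to the blocks with `U`, and
the negation of `φ`. -/
theorem exists_ultrafilter_amalgam [Nonempty M] {ξ : Type x} (φ : L.Formula (ξ ⊕ ℕ))
    (W : Ultrafilter (ξ ⊕ BlockVar → M)) (U : Ultrafilter (ℕ → M))
    (hU : ∀ T : Set (ξ ⊕ BlockVar → M), (Set.univ : Set M).Definable L T → T ∈ W →
        ∀ᶠ (b : ℕ → M) in U, ∀ᶠ (v : ξ ⊕ BlockVar → M) in W, ∃ x, Sum.elim x (v ∘ Sum.inr) ∈ T ∧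
          ¬ φ.Realize (Sum.elim x b)) :
    ∃ W' : Ultrafilter ((ξ ⊕ BlockVar → M) × (ℕ → M)),
      (∀ T : Set (ξ ⊕ BlockVar → M), (Set.univ : Set M).Definable L T →
        ((∀ᶠ (p : (ξ ⊕ BlockVar → M) × (ℕ → M)) in W', p.1 ∈ T) ↔ T ∈ W)) ∧
      (∀ X : Set (BlockVar ⊕ ℕ → M), (Set.univ : Set M).Definable L X →
        ((∀ᶠ (p : (ξ ⊕ BlockVar → M) × (ℕ → M)) in W', Sum.elim (p.1 ∘ Sum.inr) p.2 ∈ X) ↔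
          ∀ᶠ (b : ℕ → M) in U, ∀ᶠ (v : ξ ⊕ BlockVar → M) in W, Sum.elim (v ∘ Sum.inr) b ∈ X)) ∧
      ∀ᶠ (p : (ξ ⊕ BlockVar → M) × (ℕ → M)) in W', ¬ φ.Realize (Sum.elim (p.1 ∘ Sum.inl) p.2) := by
  let Q : Set (BlockVar ⊕ ℕ → M) → Prop := fun X =>
    ∀ᶠ (b : ℕ → M) in U, ∀ᶠ (v : ξ ⊕ BlockVar → M) in W, Sum.elim (v ∘ Sum.inr) b ∈ X
  let E : Set (ξ ⊕ BlockVar → M) → Set (BlockVar ⊕ ℕ → M) →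
      Set ((ξ ⊕ BlockVar → M) × (ℕ → M)) := fun T X =>
    {p | p.1 ∈ T ∧ Sum.elim (p.1 ∘ Sum.inr) p.2 ∈ X ∧
      ¬ φ.Realize (Sum.elim (p.1 ∘ Sum.inl) p.2)}
  let F : Filter ((ξ ⊕ BlockVar → M) × (ℕ → M)) :=
    { sets := {s | ∃ T X, ((Set.univ : Set M).Definable L T ∧ T ∈ W) ∧
        ((Set.univ : Set M).Definable L X ∧ Q X) ∧ E T X ⊆ s}
      univ_sets := ⟨Set.univ, Set.univ, ⟨Set.definable_univ, Filter.univ_mem⟩,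
        ⟨Set.definable_univ, by simp [Q]⟩, Set.subset_univ _⟩
      sets_of_superset := fun ⟨T, X, h1, h2, h3⟩ h => ⟨T, X, h1, h2, h3.trans h⟩
      inter_sets := by
        rintro s s' ⟨T, X, h1, h2, h3⟩ ⟨T', X', h1', h2', h3'⟩
        refine ⟨T ∩ T', X ∩ X', ⟨h1.1.inter h1'.1, Filter.inter_mem h1.2 h1'.2⟩,
          ⟨h2.1.inter h2'.1, (h2.2.and h2'.2).mono fun b hb => hb.1.and hb.2⟩, fun p hp => ?_⟩
        exact ⟨h3 ⟨hp.1.1, hp.2.1.1, hp.2.2⟩, h3' ⟨hp.1.2, hp.2.1.2, hp.2.2⟩⟩ }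
  have : F.NeBot := by
    refine Filter.neBot_iff.2 fun hbot => ?_
    have : (∅ : Set ((ξ ⊕ BlockVar → M) × (ℕ → M))) ∈ F := by rw [hbot]; trivial
    obtain ⟨T, X, h1, h2, h3⟩ := this
    -- Choose `b` first, then `v`, and finally replace the `ξ`-part of `v` by `x`: the condition `X`
    -- only sees the blocks, so it survives.
    obtain ⟨b, hb, hb'⟩ := ((hU T h1.1 h1.2).and h2.2).exists
    obtain ⟨v, ⟨x, hx, hn⟩, hv⟩ := (hb.and hb').exists
    exact h3 (show (Sum.elim x (v ∘ Sum.inr), b) ∈ E T X from ⟨hx, hv, hn⟩)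
  have hF : ∀ T X, (Set.univ : Set M).Definable L T → T ∈ W → (Set.univ : Set M).Definable L X →
      Q X → E T X ∈ Ultrafilter.of F := fun T X h1 h2 h3 h4 =>
    Ultrafilter.of_le F ⟨T, X, ⟨h1, h2⟩, ⟨h3, h4⟩, subset_rfl⟩
  have huniv : Q Set.univ := by simp [Q]
  refine ⟨Ultrafilter.of F, fun T hT => ⟨fun h => ?_, fun h => ?_⟩,
    fun X hX => ⟨fun h => ?_, fun h => ?_⟩, ?_⟩
  -- Definable sets are decided by `W`, so the forward implications follow by applying `hF` to
  -- complements.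
  · by_contra hTW
    have hc := hF Tᶜ Set.univ hT.compl (Ultrafilter.compl_mem_iff_notMem.2 hTW)
      Set.definable_univ huniv
    obtain ⟨p, hp, hp'⟩ := Filter.nonempty_of_mem (Filter.inter_mem h hc)
    exact hp'.1 hp
  · exact Filter.mem_of_superset (hF T Set.univ hT h Set.definable_univ huniv) fun p hp => hp.1
  · by_contra hQ
    have hQ' : Q Xᶜ := by
      rw [← Ultrafilter.eventually_not] at hQ
      exact hQ.mono fun b hb => Ultrafilter.eventually_not.2 hb
    have hc := hF Set.univ Xᶜ Set.definable_univ Filter.univ_mem hX.compl hQ'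
    obtain ⟨p, hp, hp'⟩ := Filter.nonempty_of_mem (Filter.inter_mem h hc)
    exact hp'.2.1 hp
  · exact Filter.mem_of_superset (hF Set.univ X Set.definable_univ Filter.univ_mem hX h)
      fun p hp => hp.2.1
  · exact Filter.mem_of_superset
      (hF Set.univ Set.univ Set.definable_univ Filter.univ_mem Set.definable_univ huniv)
      fun p hp => hp.2.2

theorem definable_realize_inl {ξ : Type x} (φ : L.Formula (ξ ⊕ ℕ)) (b : ℕ → M) :
    (Set.univ : Set M).Definable L
      {v : ξ ⊕ BlockVar → M | φ.Realize (Sum.elim (v ∘ Sum.inl) b)} :=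
  definable_realize φ (f := fun v : ξ ⊕ BlockVar → M => Sum.elim (v ∘ Sum.inl) b) (by
    rintro (a | i)
    · exact Or.inr ⟨Sum.inl a, fun _ => rfl⟩
    · exact Or.inl ⟨b i, fun _ => rfl⟩)

theorem definable_realize_block {ξ : Type x} (φ : L.Formula (ξ ⊕ ℕ)) (j : ℕ) (e : Bool) :
    (Set.univ : Set M).Definable L
      {v : ξ ⊕ BlockVar → M | φ.Realize (Sum.elim (v ∘ Sum.inl) (block v j e))} :=
  definable_realize φ
    (f := fun v : ξ ⊕ BlockVar → M => Sum.elim (v ∘ Sum.inl) (block v j e)) (by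
    rintro (a | i)
    · exact Or.inr ⟨Sum.inl a, fun _ => rfl⟩
    · exact Or.inr ⟨Sum.inr (j, e, i), fun _ => rfl⟩)

/-- The new `true` block is a tuple `b` of `C`, where `φ` holds by `hC`; the new `false` block
follows the same ultrafilter `U` relative to the older blocks but is amalgamated with the negation
of `φ`, which `h` makes possible. -/
theorem Alternates.step [Nonempty M] {ξ : Type x} {φ : L.Formula (ξ ⊕ ℕ)}
    {Γ : Set (Set (ξ → M))} {N : Set M} {k : ℕ} {W : Ultrafilter (ξ ⊕ BlockVar → M)}
    (hW : Alternates φ Γ N k W) (hΓ : ∀ S ∈ Γ, (Set.univ : Set M).Definable L S)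
    (C : Set (ℕ → M))
    (hC : ∀ b ∈ C, ∀ᶠ (v : ξ ⊕ BlockVar → M) in W, φ.Realize (Sum.elim (v ∘ Sum.inl) b))
    (h : ∀ T : Set (ξ ⊕ BlockVar → M), (Set.univ : Set M).Definable L T → T ∈ W →
      ∃ b ∈ C, ∀ᶠ (v : ξ ⊕ BlockVar → M) in W, ∃ x, Sum.elim x (v ∘ Sum.inr) ∈ T ∧
        ¬ φ.Realize (Sum.elim x b)) :
    ∃ W', Alternates φ Γ (N ∪ ⋃ b ∈ C, Set.range b) (k + 1) W' := by
  obtain ⟨U, hCU, hU⟩ := exists_ultrafilter_not_implied φ W C h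
  obtain ⟨W1, hW1, hX, hneg⟩ := exists_ultrafilter_amalgam φ W U hU
  refine ⟨U.bind fun b => W1.map fun p => updateBlocks k p.1 p.2 b, ?_, ?_, ?_, ?_⟩
  · intro S hS
    have : ∀ᶠ (p : (ξ ⊕ BlockVar → M) × (ℕ → M)) in W1, p.1 ∈ {v : ξ ⊕ BlockVar → M | v ∘ Sum.inl ∈ S} :=
      (hW1 _ (definable_preimage (f := fun v : ξ ⊕ BlockVar → M => v ∘ Sum.inl)
        (fun i => Or.inr ⟨Sum.inl i, fun _ => rfl⟩) (hΓ S hS))).2 (hW.mem S hS)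
    exact Filter.Eventually.of_forall (f := (U : Filter (ℕ → M))) fun b => this
  · intro j hj
    rcases Nat.lt_succ_iff_lt_or_eq.1 hj with hj | rfl
    · have : ∀ᶠ (p : (ξ ⊕ BlockVar → M) × (ℕ → M)) in W1, p.1 ∈ {v : ξ ⊕ BlockVar → M |
          φ.Realize (Sum.elim (v ∘ Sum.inl) (block v j true)) ∧
          ¬ φ.Realize (Sum.elim (v ∘ Sum.inl) (block v j false))} :=
        (hW1 _ ((definable_realize_block φ j true).inter
          (definable_realize_block φ j false).compl)).2 (hW.alt j hj)
      refine Filter.Eventually.of_forall (f := (U : Filter (ℕ → M))) fun b =>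
        this.mono fun p hp => ?_
      change _ ∧ _
      rw [block_updateBlocks_of_ne hj.ne, block_updateBlocks_of_ne hj.ne]
      exact hp
    · refine Filter.mem_of_superset (f := (U : Filter (ℕ → M))) hCU fun b hb => ?_
      have h1 := (hW1 _ (definable_realize_inl φ b)).2 (hC b hb)
      refine (h1.and hneg).mono fun p hp => ?_
      change _ ∧ _
      rw [block_updateBlocks_true, block_updateBlocks_false]
      exact hp
  · intro S hS hev
    have hev' : ∀ᶠ (b : ℕ → M) in U, ∀ᶠ (p : (ξ ⊕ BlockVar → M) × (ℕ → M)) in W1, updateBlocks k p.1 p.2 b ∘ Sum.inr ∈ S := hev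
    -- Finite satisfiability is obtained one block at a time: the two new blocks are chosen in `C`,
    -- after which the older ones come from `hW.finsat`.
    obtain ⟨b, hb, hbC⟩ := (hev'.and hCU).exists
    let f : (BlockVar ⊕ ℕ → M) → BlockVar → M := fun y q =>
      if q.1 = k then (if q.2.1 then b q.2.2 else y (Sum.inr q.2.2)) else y (Sum.inl q)
    have hf : (Set.univ : Set M).Definable L (f ⁻¹' S) := by
      refine definable_preimage (fun q => ?_) hS
      by_cases hq : q.1 = k
      · by_cases hq' : q.2.1 = true
        · exact Or.inl ⟨b q.2.2, trivial, fun c => by simp [f, hq, hq']⟩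
        · exact Or.inr ⟨Sum.inr q.2.2, fun c => by simp [f, hq, hq']⟩
      · exact Or.inr ⟨Sum.inl q, fun c => by simp [f, hq]⟩
    obtain ⟨b', hb', hbC'⟩ := (((hX _ hf).1 hb).and hCU).exists
    let g : (BlockVar → M) → BlockVar → M := fun y => f (Sum.elim y b')
    have hg : (Set.univ : Set M).Definable L (g ⁻¹' S) := by
      refine definable_preimage (fun q => ?_) hS
      by_cases hq : q.1 = k
      · by_cases hq' : q.2.1 = true
        · exact Or.inl ⟨b q.2.2, trivial, fun c => by simp [g, f, hq, hq']⟩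
        · exact Or.inl ⟨b' q.2.2, trivial, fun c => by simp [g, f, hq, hq']⟩
      · exact Or.inr ⟨q, fun c => by simp [g, f, hq]⟩
    obtain ⟨y, hy, hyN⟩ := hW.finsat _ hg hb'
    refine ⟨g y, hy, fun q => ?_⟩
    by_cases hq : q.1 = k
    · refine Or.inr ?_
      by_cases hq' : q.2.1 = true
      · exact Set.mem_biUnion hbC (by simp [g, f, hq, hq'])
      · exact Set.mem_biUnion hbC' (by simp [g, f, hq, hq'])
    · exact Or.inl (by simpa [g, f, hq] using hyN q)
  · intro η η' S hS
    let r : (ℕ → Bool) → (ℕ → M) → (BlockVar → M) → ℕ × ℕ → M := fun η b y p =>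
      if p.1 = k then b p.2 else y (p.1, η p.1, p.2)
    have hr : ∀ η b, (Set.univ : Set M).Definable L (r η b ⁻¹' S) := by
      intro η b
      refine definable_preimage (fun q => ?_) hS
      by_cases hq : q.1 = k
      · exact Or.inl ⟨b q.2, trivial, fun c => by simp [r, hq]⟩
      · exact Or.inr ⟨(q.1, η q.1, q.2), fun c => by simp [r, hq]⟩
    have hr' : ∀ η, (Set.univ : Set M).Definable L
        ((fun y : BlockVar ⊕ ℕ → M => r η (y ∘ Sum.inr) (y ∘ Sum.inl)) ⁻¹' S) := by
      intro η
      refine definable_preimage (fun q => ?_) hS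
      by_cases hq : q.1 = k
      · exact Or.inr ⟨Sum.inr q.2, fun c => by simp [r, hq]⟩
      · exact Or.inr ⟨Sum.inl (q.1, η q.1, q.2), fun c => by simp [r, hq]⟩
    -- Whichever member of the new pair is chosen, its joint type with the chosen older blocks is
    -- given by the same iterated limit along `U`, then `W`; the older choices are then exchanged
    -- with `b` as a parameter.
    have hkey : ∀ η : ℕ → Bool, (∀ᶠ (b : ℕ → M) in U, ∀ᶠ (p : (ξ ⊕ BlockVar → M) × (ℕ → M)) in W1,
        (fun q : ℕ × ℕ => block (updateBlocks k p.1 p.2 b) q.1 (η q.1) q.2) ∈ S) ↔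
        ∀ᶠ (b : ℕ → M) in U, ∀ᶠ (v : ξ ⊕ BlockVar → M) in W, r η b (v ∘ Sum.inr) ∈ S := by
      intro η
      cases hη : η k
      · have : ∀ (p : (ξ ⊕ BlockVar → M) × (ℕ → M)) (b : ℕ → M),
            (fun q : ℕ × ℕ => block (updateBlocks k p.1 p.2 b) q.1 (η q.1) q.2) =
              r η p.2 (p.1 ∘ Sum.inr) := by
          intro p b
          funext q
          by_cases hq : q.1 = k
          · simp [r, hq, hη, block_updateBlocks_false]
          · simp [r, hq, block, updateBlocks]
        simp only [this, Filter.eventually_const]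
        exact hX _ (hr' η)
      · have : ∀ (p : (ξ ⊕ BlockVar → M) × (ℕ → M)) (b : ℕ → M),
            (fun q : ℕ × ℕ => block (updateBlocks k p.1 p.2 b) q.1 (η q.1) q.2) =
              r η b (p.1 ∘ Sum.inr) := by
          intro p b
          funext q
          by_cases hq : q.1 = k
          · simp [r, hq, hη, block_updateBlocks_true]
          · simp [r, hq, block, updateBlocks]
        simp only [this]
        refine Filter.eventually_congr (Filter.Eventually.of_forall fun b => ?_)
        exact hW1 _ (definable_preimage (f := fun v : ξ ⊕ BlockVar → M => v ∘ Sum.inr)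
          (fun i => Or.inr ⟨Sum.inr i, fun _ => rfl⟩) (hr η b))
    intro hev
    refine (hkey η').2 (((hkey η).1 hev).mono fun b hb => ?_)
    let s : (ℕ × ℕ → M) → ℕ × ℕ → M := fun y p => if p.1 = k then b p.2 else y p
    have hs : (Set.univ : Set M).Definable L (s ⁻¹' S) := by
      refine definable_preimage (fun q => ?_) hS
      by_cases hq : q.1 = k
      · exact Or.inl ⟨b q.2, trivial, fun c => by simp [s, hq]⟩
      · exact Or.inr ⟨q, fun c => by simp [s, hq]⟩
    exact hW.symm η η' _ hs hb

/-- The number of alternations is bounded by the size of the sets that `φ` shatters. -/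
theorem Alternates.exists_shattered [Nonempty M] {ξ : Type x} {φ : L.Formula (ξ ⊕ ℕ)}
    {Γ : Set (Set (ξ → M))} {N : Set M} {k : ℕ} {W : Ultrafilter (ξ ⊕ BlockVar → M)}
    (hW : Alternates φ Γ N k W) :
    ∃ b : Fin k → ℕ → M, ∀ s : Set (Fin k), ∃ a : ξ → M,
      ∀ i, φ.Realize (Sum.elim a (b i)) ↔ i ∈ s := by
  classical
  have key : ∀ s : Set (Fin k), ∀ᶠ (v : ξ ⊕ BlockVar → M) in W, ∃ a : ξ → M, ∀ i : Fin k,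
      φ.Realize (Sum.elim a (block v i false)) ↔ i ∈ s := by
    intro s
    let S : Set (ℕ × ℕ → M) := {y | ∃ a : ξ → M, Sum.elim y a ∈ ⋂ i ∈ (Set.univ : Set (Fin k)),
      {z : ℕ × ℕ ⊕ ξ → M | φ.Realize (Sum.elim (z ∘ Sum.inr) fun n => z (Sum.inl (i, n))) ↔ i ∈ s}}
    have hS : (Set.univ : Set M).Definable L S := by
      refine definable_exists (definable_biInter Set.finite_univ fun i _ => ?_)
      have hi := definable_realize (M := M) φ (f := fun z : ℕ × ℕ ⊕ ξ → M =>
        Sum.elim (z ∘ Sum.inr) fun n => z (Sum.inl (i, n))) (by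
          rintro (a | n)
          · exact Or.inr ⟨Sum.inr a, fun _ => rfl⟩
          · exact Or.inr ⟨Sum.inl (i, n), fun _ => rfl⟩)
      by_cases his : i ∈ s
      · simpa [his] using hi
      · simp only [his, iff_false]
        exact hi.compl
    have h1 : ∀ᶠ (v : ξ ⊕ BlockVar → M) in W, ∀ i : Fin k,
        φ.Realize (Sum.elim (v ∘ Sum.inl) (block v i true)) ∧
          ¬ φ.Realize (Sum.elim (v ∘ Sum.inl) (block v i false)) :=
      Filter.eventually_all.2 fun i => hW.alt i i.2
    -- Choosing the `true` block exactly at the indices in `s` makes `v ∘ Sum.inl` realize the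
    -- pattern `s`. Symmetry moves the existential statement to the `false` blocks, which are the
    -- same for every `s`.
    have h2 := hW.symm (fun j => if h : j < k then decide (⟨j, h⟩ ∈ s) else false)
      (fun _ => false) S hS (h1.mono fun v hv => ⟨v ∘ Sum.inl, by
        simp only [Set.mem_iInter, Set.mem_ofPred_eq]
        intro i _
        by_cases his : i ∈ s
        · simpa [his, Function.comp_def] using (hv i).1
        · simpa [his, Function.comp_def] using (hv i).2⟩)
    refine h2.mono fun v ⟨a, ha⟩ => ⟨a, fun i => ?_⟩
    simp only [Set.mem_iInter, Set.mem_ofPred_eq] at ha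
    exact ha i trivial
  obtain ⟨v, hv⟩ := (Filter.eventually_all.2 key).exists
  exact ⟨fun i => block v i false, hv⟩

end Alternation

/-! ### Finite intersection property and cardinal arithmetic at a singular cardinal. -/

/-- The finite intersection property. -/
def FinInter {X : Type x} (Γ : Set (Set X)) : Prop :=
  ∀ F : Finset (Set X), ↑F ⊆ Γ → ∃ x, ∀ S ∈ F, x ∈ S

theorem FinInter.neBot_generate {X : Type x} {Γ : Set (Set X)} (h : FinInter Γ) :
    (Filter.generate Γ).NeBot := by
  refine Filter.neBot_iff.2 fun hbot => ?_
  have : (∅ : Set X) ∈ Filter.generate Γ := by rw [hbot]; trivial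
  obtain ⟨t, ht, hfin, hsub⟩ := Filter.mem_generate_iff.1 this
  obtain ⟨x, hx⟩ := h hfin.toFinset (by simpa using ht)
  exact hsub (Set.mem_sInter.2 fun S hS => hx S (by simpa using hS))

section Cardinality

theorem aleph0_lt_of_isSingular {κ : Cardinal.{w}} (hκ : κ.IsSingular) : ℵ₀ < κ :=
  hκ.aleph0_le.lt_of_ne fun h => Cardinal.not_isSingular_aleph0 (h ▸ hκ)

/-- A set of singular cardinality is covered by a small family of small subsets. -/
theorem exists_small_cover {κ : Cardinal.{w}} (hκ : κ.IsSingular) {X : Type w} (B : Set X)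
    (hB : #B ≤ κ) : ∃ (J : Type w) (f : J → Set X), #J < κ ∧ (∀ j, #(f j) < κ) ∧
      (∀ j, f j ⊆ B) ∧ ∀ b ∈ B, ∃ j, b ∈ f j := by
  rw [← mk_ord_toType κ] at hB
  obtain ⟨e⟩ := hB
  obtain ⟨s, hs, hcard⟩ := Order.exists_cof_eq κ.ord.ToType
  refine ⟨s, fun j => {b | ∃ h : b ∈ B, e ⟨b, h⟩ ≤ j}, ?_, fun j => ?_, fun j b hb => hb.1,
    fun b hb => ?_⟩
  · rw [hcard, Ordinal.cof_toType]
    exact hκ.cof_ord_lt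
  · have h1 : #(Set.Iic (j : κ.ord.ToType)) < κ := by
      rw [← Set.Iio_union_right]
      refine (mk_union_le _ _).trans_lt (add_lt_of_lt hκ.aleph0_le ?_ ?_)
      · simpa using mk_Iio_lt (j : κ.ord.ToType)
      · rw [mk_singleton]
        exact_mod_cast hκ.natCast_lt 1
    refine lt_of_le_of_lt ?_ h1
    refine mk_le_of_injective (f := fun b => ⟨e ⟨b.1, b.2.1⟩, b.2.2⟩) ?_
    intro a b hab
    have := e.injective (Subtype.ext_iff.1 hab)
    simpa [Subtype.ext_iff] using this
  · obtain ⟨j, hj, hle⟩ := hs (e ⟨b, hb⟩)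
    exact ⟨⟨j, hj⟩, hb, hle⟩

theorem mk_finset_le_of_le {κ : Cardinal.{w}} (hκ : ℵ₀ ≤ κ) {X : Type w} (h : #X ≤ κ) :
    #(Finset X) ≤ κ := by
  cases finite_or_infinite X
  · exact (Cardinal.lt_aleph0_of_finite _).le.trans hκ
  · rwa [Cardinal.mk_finset_of_infinite]

theorem mk_biUnion_range_lt {κ : Cardinal.{w}} (hκ : ℵ₀ < κ) {X : Type w} (C : Set (ℕ → X))
    (hC : #C < κ) : #(⋃ b ∈ C, Set.range b : Set X) < κ := by
  refine (mk_biUnion_le _ _).trans_lt (mul_lt_of_lt hκ.le hC (lt_of_le_of_lt ?_ hκ))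
  exact ciSup_le' fun b => (Set.countable_range b.1).le_aleph0

end Cardinality

/-! ### Small sets of conditions implying all instances of one formula. -/

section Implication

variable {L : FirstOrder.Language.{u, v}} {M : Type w} [L.Structure M]

variable (L M) in
/-- Every type in countably many variables over a set of size at most `κ` which is finitely
satisfiable in a set of size less than `κ` is realized. -/
def RealizesCoheirs (κ : Cardinal.{w}) : Prop :=
  ∀ N : Set M, #N < κ → ∀ D : Ultrafilter (BlockVar → M),
    (∀ᶠ (y : BlockVar → M) in D, ∀ i, y i ∈ N) → ∀ Q : Set (Set (BlockVar → M)), #Q ≤ κ →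
    (∀ S ∈ Q, (Set.univ : Set M).Definable L S ∧ S ∈ D) → ∃ y, ∀ S ∈ Q, y ∈ S

theorem Alternates.exists_coheir {ξ : Type x} {φ : L.Formula (ξ ⊕ ℕ)}
    {Γ : Set (Set (ξ → M))} {N : Set M} {k : ℕ} {W : Ultrafilter (ξ ⊕ BlockVar → M)}
    (hW : Alternates φ Γ N k W) : ∃ D : Ultrafilter (BlockVar → M),
      (∀ᶠ (y : BlockVar → M) in D, ∀ i, y i ∈ N) ∧
      ∀ S : Set (BlockVar → M), (Set.univ : Set M).Definable L S →
        (∀ᶠ (v : ξ ⊕ BlockVar → M) in W, v ∘ Sum.inr ∈ S) → S ∈ D := by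
  let F : Filter (BlockVar → M) :=
    { sets := {s | ∃ S : Set (BlockVar → M), ((Set.univ : Set M).Definable L S ∧
        ∀ᶠ (v : ξ ⊕ BlockVar → M) in W, v ∘ Sum.inr ∈ S) ∧ S ∩ {y | ∀ i, y i ∈ N} ⊆ s}
      univ_sets := ⟨Set.univ, ⟨Set.definable_univ, by simp⟩, Set.subset_univ _⟩
      sets_of_superset := fun ⟨S, h1, h2⟩ h => ⟨S, h1, h2.trans h⟩
      inter_sets := by
        rintro s s' ⟨S, h1, h2⟩ ⟨S', h1', h2'⟩
        exact ⟨S ∩ S', ⟨h1.1.inter h1'.1, h1.2.and h1'.2⟩,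
          fun y hy => ⟨h2 ⟨hy.1.1, hy.2⟩, h2' ⟨hy.1.2, hy.2⟩⟩⟩ }
  have : F.NeBot := by
    refine Filter.neBot_iff.2 fun hbot => ?_
    have : (∅ : Set (BlockVar → M)) ∈ F := by rw [hbot]; trivial
    obtain ⟨S, h1, h2⟩ := this
    obtain ⟨y, hy, hyN⟩ := hW.finsat S h1.1 h1.2
    exact h2 (show y ∈ S ∩ {y | ∀ i, y i ∈ N} from ⟨hy, hyN⟩)
  refine ⟨Ultrafilter.of F, Ultrafilter.of_le F ?_, fun S h1 h2 => Ultrafilter.of_le F ?_⟩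
  · exact ⟨Set.univ, ⟨Set.definable_univ, by simp⟩, fun y hy => hy.2⟩
  · exact ⟨S, ⟨h1, h2⟩, fun y hy => hy.1⟩

/-- Singularity splits `B` into fewer than `κ` small pieces, each implied by a single condition `T
j` about `x` and the blocks. Realizing the blocks by some `c` in `M` makes the sets `T j` at `c` the
required family. -/
theorem exists_small_implying_of_stuck [Nonempty M] {κ : Cardinal.{w}} (hκ : κ.IsSingular)
    (hH : RealizesCoheirs L M κ) {ξ : Type} {φ : L.Formula (ξ ⊕ ℕ)} {Γ : Set (Set (ξ → M))}
    (hΓd : ∀ S ∈ Γ, (Set.univ : Set M).Definable L S) (hΓc : #Γ ≤ κ)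
    {B : Set (ℕ → M)} (hBc : #B ≤ κ) {N : Set M} (hN : #N < κ)
    {k : ℕ} {W : Ultrafilter (ξ ⊕ BlockVar → M)} (hW : Alternates φ Γ N k W)
    (hstuck : ∀ C ⊆ B, #C < κ → ∃ T : Set (ξ ⊕ BlockVar → M), (Set.univ : Set M).Definable L T ∧
      T ∈ W ∧ ∀ b ∈ C, ¬ ∀ᶠ (v : ξ ⊕ BlockVar → M) in W, ∃ x, Sum.elim x (v ∘ Sum.inr) ∈ T ∧
        ¬ φ.Realize (Sum.elim x b)) :
    ∃ Γ' : Set (Set (ξ → M)), #Γ' < κ ∧ (∀ S ∈ Γ', (Set.univ : Set M).Definable L S) ∧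
      FinInter (Γ ∪ Γ') ∧ ∀ b ∈ B, ∃ S ∈ Γ', ∀ x ∈ S, φ.Realize (Sum.elim x b) := by
  classical
  obtain ⟨J, f, hJ, hf, hfB, hcov⟩ := exists_small_cover hκ B hBc
  choose T hTd hTW hT using fun j => hstuck (f j) (hfB j) (hf j)
  obtain ⟨D, hDN, hD⟩ := hW.exists_coheir
  -- What `c` must satisfy: `S1` says that `T j` implies the instance of `φ` at `b`, and `S2` that
  -- finitely many `T j` are consistent with finitely many members of `Γ`. There are at most `κ`
  -- such conditions.
  let S1 : J × (ℕ → M) → Set (BlockVar → M) := fun p =>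
    {y | ∀ x : ξ → M, Sum.elim x y ∈ T p.1 → φ.Realize (Sum.elim x p.2)}
  let S2 : Finset Γ × Finset J → Set (BlockVar → M) := fun p =>
    {y | ∃ x : ξ → M, (∀ S ∈ p.1, x ∈ (S : Set (ξ → M))) ∧ ∀ j ∈ p.2, Sum.elim x y ∈ T j}
  have swap : ∀ j, (Set.univ : Set M).Definable L
      ((fun z : BlockVar ⊕ ξ → M => Sum.elim (z ∘ Sum.inr) (z ∘ Sum.inl)) ⁻¹' T j) := fun j =>
    definable_preimage (by
      rintro (a | q)
      · exact Or.inr ⟨Sum.inr a, fun _ => rfl⟩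
      · exact Or.inr ⟨Sum.inl q, fun _ => rfl⟩) (hTd j)
  have hS1 : ∀ p, (Set.univ : Set M).Definable L (S1 p) := by
    intro p
    have h2 : (Set.univ : Set M).Definable L
        {z : BlockVar ⊕ ξ → M | φ.Realize (Sum.elim (z ∘ Sum.inr) p.2)} :=
      definable_realize φ (f := fun z : BlockVar ⊕ ξ → M => Sum.elim (z ∘ Sum.inr) p.2) (by
        rintro (a | i)
        · exact Or.inr ⟨Sum.inr a, fun _ => rfl⟩
        · exact Or.inl ⟨p.2 i, fun _ => rfl⟩)
    have := definable_forall ((swap p.1).compl.union h2)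
    convert this using 1
    ext y
    simp only [S1, Set.mem_ofPred_eq, Set.mem_union, Set.mem_compl_iff, Set.mem_preimage,
      imp_iff_not_or]
    rfl
  have hS2 : ∀ p, (Set.univ : Set M).Definable L (S2 p) := by
    intro p
    have h1 : (Set.univ : Set M).Definable L (⋂ S ∈ (p.1 : Set Γ),
        (fun z : BlockVar ⊕ ξ → M => z ∘ Sum.inr) ⁻¹' (S : Set (ξ → M))) :=
      definable_biInter p.1.finite_toSet fun S _ =>
        definable_preimage (fun i => Or.inr ⟨Sum.inr i, fun _ => rfl⟩) (hΓd S S.2)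
    have h2 := definable_biInter p.2.finite_toSet fun j (_ : j ∈ (p.2 : Set J)) => swap j
    have := definable_exists (h1.inter h2)
    convert this using 1
    ext y
    simp only [S2, Set.mem_ofPred_eq, Set.mem_inter_iff, Set.mem_iInter, Set.mem_preimage,
      Finset.mem_coe]
    rfl
  let Q : Set (Set (BlockVar → M)) := S1 '' {p | p.2 ∈ f p.1} ∪ Set.range S2
  have hQc : #Q ≤ κ := by
    refine (mk_union_le _ _).trans (add_le_of_le hκ.aleph0_le ?_ ?_)
    · refine mk_image_le.trans ?_
      have h1 : #{p : J × (ℕ → M) | p.2 ∈ f p.1} ≤ #(J × B) :=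
        mk_le_of_injective (f := fun p => (p.1.1, ⟨p.1.2, hfB _ p.2⟩)) (by
          intro p q h
          simp only [Prod.mk.injEq, Subtype.mk.injEq] at h
          exact Subtype.ext (Prod.ext h.1 h.2))
      refine h1.trans ?_
      rw [mk_prod, lift_id, lift_id]
      exact mul_le_of_le hκ.aleph0_le hJ.le hBc
    · refine mk_range_le.trans ?_
      rw [mk_prod, lift_id, lift_id]
      exact mul_le_of_le hκ.aleph0_le (mk_finset_le_of_le hκ.aleph0_le hΓc)
        (mk_finset_le_of_le hκ.aleph0_le hJ.le)
  obtain ⟨c, hc⟩ := hH N hN D hDN Q hQc (by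
    rintro S (⟨p, hp, rfl⟩ | ⟨p, rfl⟩)
    · refine ⟨hS1 p, hD _ (hS1 p) ?_⟩
      have := Ultrafilter.eventually_not.2 (hT p.1 p.2 hp)
      refine this.mono fun v hv x hx => ?_
      by_contra hn
      exact hv ⟨x, hx, hn⟩
    · refine ⟨hS2 p, hD _ (hS2 p) ?_⟩
      have h1 : ∀ᶠ (v : ξ ⊕ BlockVar → M) in W, ∀ S ∈ p.1, v ∘ Sum.inl ∈ (S : Set (ξ → M)) :=
        (Filter.eventually_all_finset _).2 fun S _ => hW.mem S S.2
      have h2 : ∀ᶠ (v : ξ ⊕ BlockVar → M) in W, ∀ j ∈ p.2, v ∈ T j :=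
        (Filter.eventually_all_finset _).2 fun j _ => hTW j
      refine (h1.and h2).mono fun v hv => ⟨v ∘ Sum.inl, hv.1, fun j hj => ?_⟩
      rw [Sum.elim_comp_inl_inr]
      exact hv.2 j hj)
  let R : J → Set (ξ → M) := fun j => {x | Sum.elim x c ∈ T j}
  refine ⟨Set.range R, mk_range_le.trans_lt hJ, ?_, ?_, ?_⟩
  · rintro _ ⟨j, rfl⟩
    exact definable_preimage (f := fun x : ξ → M => Sum.elim x c) (by
      rintro (a | q)
      · exact Or.inr ⟨a, fun _ => rfl⟩
      · exact Or.inl ⟨c q, trivial, fun _ => rfl⟩) (hTd j)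
  · intro F hF
    choose j hj using fun S : Set.range R => S.2
    obtain ⟨x, hx1, hx2⟩ := hc _ (Or.inr ⟨(F.subtype (· ∈ Γ),
      (F.subtype (· ∈ Set.range R)).image j), rfl⟩)
    refine ⟨x, fun S hS => ?_⟩
    rcases hF hS with h | h
    · exact hx1 ⟨S, h⟩ (by simpa using hS)
    · have := hx2 (j ⟨S, h⟩) (Finset.mem_image_of_mem _ (by simpa using hS))
      exact (hj ⟨S, h⟩).subset this
  · intro b hb
    obtain ⟨j, hj⟩ := hcov b hb
    exact ⟨R j, ⟨j, rfl⟩, fun x hx => hc _ (Or.inl ⟨(j, b), hj, rfl⟩) x hx⟩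

/-- If the conclusion fails, the construction is never stuck, so there are arbitrarily many
alternating pairs and `φ` shatters sets of every finite size. -/
theorem exists_small_implying [Nonempty M] {T : L.Theory} [M ⊨ T] (hT : IsDependent.{u, v, w} T)
    {κ : Cardinal.{w}} (hκ : κ.IsSingular) (hH : RealizesCoheirs L M κ) {ξ : Type}
    (φ : L.Formula (ξ ⊕ ℕ)) {Γ : Set (Set (ξ → M))}
    (hΓd : ∀ S ∈ Γ, (Set.univ : Set M).Definable L S) (hΓc : #Γ ≤ κ) (hΓ : FinInter Γ)
    {B : Set (ℕ → M)} (hBc : #B ≤ κ) (hB : ∀ b ∈ B, {x | φ.Realize (Sum.elim x b)} ∈ Γ) :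
    ∃ Γ' : Set (Set (ξ → M)), #Γ' < κ ∧ (∀ S ∈ Γ', (Set.univ : Set M).Definable L S) ∧
      FinInter (Γ ∪ Γ') ∧ ∀ b ∈ B, ∃ S ∈ Γ', ∀ x ∈ S, φ.Realize (Sum.elim x b) := by
  by_contra hcon
  have := hΓ.neBot_generate
  have key : ∀ k : ℕ, ∃ N : Set M, #N < κ ∧ ∃ W, Alternates φ Γ N k W := by
    intro k
    induction k with
    | zero =>
      refine ⟨{Classical.arbitrary M}, ?_, exists_alternates_zero φ Γ _⟩
      rw [mk_singleton]
      exact_mod_cast hκ.natCast_lt 1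
    | succ k ih =>
      obtain ⟨N, hN, W, hW⟩ := ih
      by_cases hfail : ∃ C ⊆ B, #C < κ ∧ ∀ T : Set (ξ ⊕ BlockVar → M),
          (Set.univ : Set M).Definable L T → T ∈ W →
          ∃ b ∈ C, ∀ᶠ (v : ξ ⊕ BlockVar → M) in W, ∃ x, Sum.elim x (v ∘ Sum.inr) ∈ T ∧
            ¬ φ.Realize (Sum.elim x b)
      · obtain ⟨C, hCB, hCc, hC⟩ := hfail
        refine ⟨_, ?_, hW.step hΓd C (fun b hb => hW.mem _ (hB b (hCB hb))) hC⟩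
        exact (mk_union_le _ _).trans_lt (add_lt_of_lt hκ.aleph0_le hN
          (mk_biUnion_range_lt (aleph0_lt_of_isSingular hκ) C hCc))
      · refine absurd (exists_small_implying_of_stuck hκ hH hΓd hΓc hBc hN hW ?_) hcon
        intro C hCB hCc
        by_contra hT'
        refine hfail ⟨C, hCB, hCc, fun T' hT1 hT2 => ?_⟩
        by_contra hT3
        exact hT' ⟨T', hT1, hT2, fun b hb hev => hT3 ⟨b, hb, hev⟩⟩
  obtain ⟨n, hn⟩ := hT.exists_not_shattered (M := M) φ
  obtain ⟨N, -, W, hW⟩ := key n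
  obtain ⟨b, hb⟩ := hW.exists_shattered
  obtain ⟨s, hs⟩ := hn b
  obtain ⟨a, ha⟩ := hb s
  exact hs a ha

end Implication

/-- A finite subfamily already appears at the largest index that it involves. -/
theorem FinInter.union_biUnion {X : Type x} {ι : Type y} [LinearOrder ι] {Γ : Set (Set X)}
    (hΓ : FinInter Γ) (c : ι → Set (Set X)) (t : Set ι)
    (h : ∀ i ∈ t, FinInter (Γ ∪ (⋃ j ∈ Set.Iio i, c j) ∪ c i)) :
    FinInter (Γ ∪ ⋃ i ∈ t, c i) := by
  classical
  intro F hF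
  let F' : Finset (Set X) := F.filter (· ∉ Γ)
  have hF' : ∀ S : F', ∃ i ∈ t, (S : Set X) ∈ c i := by
    rintro ⟨S, hS⟩
    obtain ⟨hS1, hS2⟩ := Finset.mem_filter.1 hS
    simpa using (hF hS1).resolve_left hS2
  choose i hit hic using hF'
  rcases F'.eq_empty_or_nonempty with he | ⟨S0, hS0⟩
  · refine hΓ F fun S hS => ?_
    by_contra hn
    have : S ∈ F' := Finset.mem_filter.2 ⟨hS, hn⟩
    simp [he] at this
  · have hne : (Finset.univ.image i).Nonempty := ⟨_, Finset.mem_image_of_mem i (Finset.mem_univ ⟨S0, hS0⟩)⟩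
    obtain ⟨S1, -, hS1⟩ := Finset.mem_image.1 (Finset.max'_mem _ hne)
    refine h (i S1) (hit S1) F fun S hS => ?_
    by_cases hSΓ : S ∈ Γ
    · exact Or.inl (Or.inl hSΓ)
    · let S' : F' := ⟨S, Finset.mem_filter.2 ⟨hS, hSΓ⟩⟩
      have hle : i S' ≤ i S1 := by
        rw [hS1]
        exact Finset.le_max' _ _ (Finset.mem_image_of_mem i (Finset.mem_univ S'))
      rcases hle.lt_or_eq with hlt | heq
      · exact Or.inl (Or.inr (Set.mem_biUnion hlt (hic S')))
      · exact Or.inr (heq ▸ hic S')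

section Cardinality

theorem mk_biUnion_lt_of_lt_cof {κ : Cardinal.{w}} (hκ : κ.IsSingular) {X : Type w}
    {ι : Type x} (hι : Cardinal.lift.{w} #ι < Cardinal.lift.{x} κ.ord.cof) (c : ι → Set X)
    (t : Set ι) (hc : ∀ i ∈ t, #(c i) < κ) : #(⋃ i ∈ t, c i : Set X) < κ := by
  have ht : Cardinal.lift.{w} #t < Cardinal.lift.{x} κ.ord.cof :=
    (lift_le.2 (mk_set_le t)).trans_lt hι
  have hsup : ⨆ i : t, #(c i) < κ := by
    refine Cardinal.lift_iSup_lt_of_lt_cof_ord ?_ fun i => hc i i.2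
    rwa [← lift_ord, ← Ordinal.lift_cof]
  rw [← Cardinal.lift_lt.{w, x}]
  refine (mk_biUnion_le_lift c t).trans_lt ?_
  refine mul_lt_of_lt (aleph0_le_lift.2 hκ.aleph0_le) (ht.trans (lift_lt.2 hκ.cof_ord_lt)) ?_
  rw [← lift_iSup ⟨κ, by rintro _ ⟨i, rfl⟩; exact (hc i i.2).le⟩]
  exact lift_lt.2 hsup

theorem mk_formula_le {L : FirstOrder.Language.{u, v}} {α : Type x} :
    #(L.Formula α) ≤ max ℵ₀ (Cardinal.lift.{max u v} #α + Cardinal.lift.{x} L.card) := by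
  refine le_trans ?_ FirstOrder.Language.BoundedFormula.card_le
  exact mk_le_of_injective (f := fun φ => ⟨0, φ⟩) fun φ ψ h => by simpa using h

theorem lift_mk_formula_le {L : FirstOrder.Language.{u, v}} {κ : Cardinal.{w}} (hκ : ℵ₀ ≤ κ)
    (hL : Cardinal.lift.{w} (theoryCard L) ≤ Cardinal.lift.{max u v} κ) {α : Type x}
    (hα : Cardinal.lift.{w} #α ≤ Cardinal.lift.{x} κ) :
    Cardinal.lift.{w} #(L.Formula α) ≤ Cardinal.lift.{max u v x} κ := by
  refine (lift_le.2 mk_formula_le).trans ?_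
  rw [lift_max, lift_aleph0, lift_add, lift_lift, lift_lift]
  refine max_le (aleph0_le_lift.2 hκ) (add_le_of_le (aleph0_le_lift.2 hκ) ?_ ?_)
  · have := lift_le.{max u v}.2 hα
    simpa only [lift_lift, lift_umax] using this
  · have h1 : Cardinal.lift.{w} L.card ≤ Cardinal.lift.{max u v} κ :=
      (lift_le.2 (le_max_right _ _)).trans hL
    have := lift_le.{x}.2 h1
    simpa only [lift_lift, lift_umax] using this

theorem mk_formula_le_theoryCard {L : FirstOrder.Language.{u, v}} {α : Type} [Countable α] :
    #(L.Formula α) ≤ theoryCard L := by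
  have := lift_mk_formula_le (L := L) (κ := theoryCard L) (le_max_left _ _) (by simp) (α := α) (by
    rw [lift_uzero]
    exact (lift_le.2 (mk_le_aleph0 (α := α))).trans (by simp [theoryCard]))
  simpa using this

end Cardinality

/-! ### From exact saturation to an omitted coheir. -/

section Omitting

variable {L : FirstOrder.Language.{u, v}} {M : Type w} [L.Structure M]

theorem exists_realize_of_definable [Nonempty M] {A : Set M} {ξ : Type x} {S : Set (ξ → M)}
    (hS : A.Definable L S) : ∃ (φ : L.Formula (ξ ⊕ ℕ)) (b : ℕ → M),
      ∀ x, x ∈ S ↔ φ.Realize (Sum.elim x b) := by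
  obtain ⟨A0, -, hA0⟩ := Set.definable_iff_finitely_definable.1 hS
  obtain ⟨χ, rfl⟩ := definable_iff_sat.1 hA0
  obtain ⟨e, he⟩ := exists_injective_nat (A0 : Set M)
  refine ⟨χ.relabel (Sum.elim (fun a => Sum.inr (e a)) Sum.inl),
    Function.extend e (fun a => (a : M)) fun _ => Classical.arbitrary M, fun x => ?_⟩
  rw [FirstOrder.Language.Formula.realize_relabel]
  refine iff_of_eq (congrArg χ.Realize (funext ?_))
  rintro (a | i)
  · simp [he.extend_apply]
  · rfl

theorem exists_small_support {ξ : Type} {Γ : Set (Set (ξ → M))}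
    (hΓ : ∀ S ∈ Γ, (Set.univ : Set M).Definable L S) :
    ∃ A : Set M, (∀ S ∈ Γ, A.Definable L S) ∧ #A ≤ max #Γ ℵ₀ := by
  choose A0 _ hA0 using fun S : Γ => Set.definable_iff_finitely_definable.1 (hΓ S S.2)
  refine ⟨⋃ S, (A0 S : Set M), fun S hS =>
    (hA0 ⟨S, hS⟩).mono (Set.subset_iUnion (fun S => (A0 S : Set M)) _), ?_⟩
  refine (mk_iUnion_le fun S => (A0 S : Set M)).trans ((mul_le_max _ _).trans ?_)
  refine max_le (max_le (le_max_left _ _) ?_) (le_max_right _ _)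
  exact (ciSup_le' fun S => (A0 S).countable_toSet.le_aleph0).trans (le_max_right _ _)

theorem IsSaturated.exists_mem_of_finInter {κ : Cardinal.{w}} (hκ : ℵ₀ < κ)
    (hM : IsSaturated L M κ) {Γ : Set (Set (Fin 1 → M))}
    (hΓ : ∀ S ∈ Γ, (Set.univ : Set M).Definable L S) (hΓc : #Γ < κ) (hfin : FinInter Γ) :
    ∃ x, ∀ S ∈ Γ, x ∈ S := by
  obtain ⟨A, hA, hAc⟩ := exists_small_support hΓ
  have := hfin.neBot_generate
  obtain ⟨c, hc⟩ := hM.exists_sat_one (hAc.trans_lt (max_lt hΓc hκ)) (Filter.generate Γ)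
  refine ⟨c, fun S hS => ?_⟩
  obtain ⟨χ, rfl⟩ := definable_iff_sat.1 (hA S hS)
  exact hc χ (Filter.mem_generate_of_mem hS)

/-- If the coheirs of small sets are realized over sets of size `κ`, then a `κ`-saturated model
is `κ⁺`-saturated. -/
theorem isSaturated_succ_of_realizesCoheirs [Nonempty M] {T : L.Theory} [M ⊨ T]
    (hT : IsDependent.{u, v, w} T) {κ : Cardinal.{w}} (hκ : κ.IsSingular)
    (hcof : Cardinal.lift.{w} (theoryCard L) < Cardinal.lift.{max u v} κ.ord.cof)
    (hM : IsSaturated L M κ) (hH : RealizesCoheirs L M κ) :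
    IsSaturated L M (Order.succ κ) := by
  classical
  intro A hA p hp
  rw [Order.lt_succ_iff] at hA
  let Γ : Set (Set (Fin 1 → M)) := (fun χ : ParamFormula L A (Fin 1) => {c | Sat χ c}) '' p
  have hL : Cardinal.lift.{w} (theoryCard L) ≤ Cardinal.lift.{max u v} κ :=
    hcof.le.trans (lift_le.2 hκ.cof_ord_lt.le)
  have hΓd : ∀ S ∈ Γ, (Set.univ : Set M).Definable L S := by
    rintro _ ⟨χ, -, rfl⟩
    exact (definable_sat χ).mono (Set.subset_univ _)
  have hΓc : #Γ ≤ κ := by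
    rw [← Cardinal.lift_le.{max u v w}]
    refine mk_image_le_lift.trans ((lift_le.2 (mk_set_le p)).trans ?_)
    have := lift_mk_formula_le hκ.aleph0_le hL (α := A ⊕ Fin 1) (by
      rw [Cardinal.lift_id, Cardinal.lift_id, mk_sum, Cardinal.lift_uzero]
      refine add_le_of_le hκ.aleph0_le hA ?_
      simpa using (hκ.natCast_lt 1).le)
    exact this
  have hΓfin : FinInter Γ := by
    intro F hF
    choose χ hχp hχ using fun S : F => hF S.2
    obtain ⟨c, hc⟩ := hp.1 (Finset.univ.image χ) (by
      intro ψ hψ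
      obtain ⟨S, -, rfl⟩ := Finset.mem_image.1 (Finset.mem_coe.1 hψ)
      exact hχp S)
    refine ⟨c, fun S hS => ?_⟩
    have h1 := hc (χ ⟨S, hS⟩) (Finset.mem_image_of_mem _ (Finset.mem_univ _))
    exact (hχ ⟨S, hS⟩).subset h1
  choose φ b hφb using fun S : Γ => exists_realize_of_definable (hΓd S S.2)
  let B : L.Formula (Fin 1 ⊕ ℕ) → Set (ℕ → M) := fun ψ => b '' {S | φ S = ψ}
  have hBc : ∀ ψ, #(B ψ) ≤ κ := fun ψ => mk_image_le.trans ((mk_set_le _).trans hΓc)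
  have hB : ∀ ψ, ∀ z ∈ B ψ, {x | ψ.Realize (Sum.elim x z)} ∈ Γ := by
    rintro ψ _ ⟨S, rfl, rfl⟩
    convert S.2 using 1
    ext x
    exact (hφb S x).symm
  obtain ⟨_, _⟩ := exists_wellFoundedLT (L.Formula (Fin 1 ⊕ ℕ))
  have hΦ : Cardinal.lift.{w} #(L.Formula (Fin 1 ⊕ ℕ)) < Cardinal.lift.{max u v} κ.ord.cof :=
    (lift_le.2 mk_formula_le_theoryCard).trans_lt hcof
  -- Recursion over all formulas `ψ`: stage `ψ` adds a small family implying the `ψ`-instances of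
  -- `p`, consistent with everything added before. The union stays of size less than `κ` because
  -- there are fewer than `cf κ` formulas.
  obtain ⟨c, hc⟩ := exists_forall_rel_of_wellFounded
    (fun (ψ : L.Formula (Fin 1 ⊕ ℕ)) (c : L.Formula (Fin 1 ⊕ ℕ) → Set (Set (Fin 1 → M)))
      (Γ' : Set (Set (Fin 1 → M))) =>
      #Γ' < κ ∧ (∀ S ∈ Γ', (Set.univ : Set M).Definable L S) ∧
        FinInter (Γ ∪ (⋃ χ ∈ Set.Iio ψ, c χ) ∪ Γ') ∧
        ∀ z ∈ B ψ, ∃ S ∈ Γ', ∀ x ∈ S, ψ.Realize (Sum.elim x z))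
    (by
      rintro ψ c c' Γ' h ⟨h1, h2, h3, h4⟩
      refine ⟨h1, h2, ?_, h4⟩
      have : (⋃ χ ∈ Set.Iio ψ, c' χ) = ⋃ χ ∈ Set.Iio ψ, c χ :=
        Set.iUnion₂_congr fun χ hχ => (h χ hχ).symm
      rwa [this])
    (by
      intro ψ c h
      refine exists_small_implying hT hκ hH ψ ?_ ?_ ?_ (hBc ψ) fun z hz => Or.inl (hB ψ z hz)
      · rintro S (hS | hS)
        · exact hΓd S hS
        · obtain ⟨χ, hχ, hS⟩ := Set.mem_iUnion₂.1 hS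
          exact (h χ hχ).2.1 S hS
      · refine (mk_union_le _ _).trans (add_le_of_le hκ.aleph0_le hΓc ?_)
        exact (mk_biUnion_lt_of_lt_cof hκ hΦ c _ fun χ hχ => (h χ hχ).1).le
      · exact hΓfin.union_biUnion c _ fun χ hχ => (h χ hχ).2.2.1)
  obtain ⟨x, hx⟩ := hM.exists_mem_of_finInter (aleph0_lt_of_isSingular hκ)
    (Γ := ⋃ ψ ∈ Set.univ, c ψ) (by
      intro S hS
      obtain ⟨χ, hχ, hS⟩ := Set.mem_iUnion₂.1 hS
      exact (hc χ).2.1 S hS)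
    (mk_biUnion_lt_of_lt_cof hκ hΦ c _ fun χ _ => (hc χ).1)
    (fun F hF => hΓfin.union_biUnion c Set.univ (fun χ _ => (hc χ).2.2.1) F
      (hF.trans Set.subset_union_right))
  refine ⟨x, fun χ hχ => ?_⟩
  let S : Γ := ⟨_, χ, hχ, rfl⟩
  obtain ⟨S', hS', hS''⟩ := (hc (φ S)).2.2.2 (b S) ⟨S, rfl, rfl⟩
  exact (hφb S x).2 (hS'' x (hx S' (Set.mem_biUnion (Set.mem_univ _) hS')))

theorem exists_omitted_coheir [Nonempty M] {T : L.Theory} [M ⊨ T]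
    (hT : IsDependent.{u, v, w} T) {κ : Cardinal.{w}} (hκ : κ.IsSingular)
    (hcof : Cardinal.lift.{w} (theoryCard L) < Cardinal.lift.{max u v} κ.ord.cof)
    (hM : IsExactlySaturated L M κ) (θ : Type (max u v)) (hθ : #θ = theoryCard L) :
    ∃ (N : L.ElementarySubstructure M) (A : Set M) (D : Ultrafilter (θ → N)),
      #N < κ ∧ #A = κ ∧
      Omits (average L (fun (c : θ → N) (i : θ) => (c i : M)) (D : Filter (θ → N)) A) := by
  classical
  have hnH : ¬ RealizesCoheirs L M κ := fun h =>
    hM.2 (isSaturated_succ_of_realizesCoheirs hT hκ hcof hM.1 h)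
  have hL : Cardinal.lift.{w} (theoryCard L) < Cardinal.lift.{max u v} κ :=
    hcof.trans (lift_lt.2 hκ.cof_ord_lt)
  -- `A0` serves only to bring the parameter set up to size exactly `κ`.
  obtain ⟨A0, hA0⟩ : ∃ A0 : Set M, #A0 = κ := by
    have h := hM.2
    simp only [IsSaturated, not_forall] at h
    obtain ⟨A0, hA0, p, hp, hnp⟩ := h
    refine ⟨A0, le_antisymm (Order.lt_succ_iff.1 hA0) (not_lt.1 fun hlt => hnp (hM.1 A0 hlt p hp))⟩
  simp only [RealizesCoheirs, not_forall] at hnH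
  obtain ⟨N0, hN0, D, hDN, Q, hQc, hQ, hQo⟩ := hnH
  obtain ⟨A1, hA1, hA1c⟩ := exists_small_support fun S hS => (hQ S hS).1
  obtain ⟨μ, hμ⟩ := mem_range_lift_of_le hL.le
  have hμκ : μ < κ := by rwa [← hμ, lift_lt] at hL
  have hμ0 : ℵ₀ ≤ μ := by
    rw [← aleph0_le_lift.{w, max u v}, hμ, aleph0_le_lift]
    exact le_max_left _ _
  obtain ⟨N, hNs, hNc⟩ := FirstOrder.Language.exists_elementarySubstructure_card_eq L N0
    (max #N0 μ) (hμ0.trans (le_max_right _ _)) (lift_le.2 (le_max_left _ _))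
    ((lift_le.2 (le_max_right _ _)).trans (hμ.ge.trans (lift_le.2 (le_max_right _ _))))
    (lift_le.2 (max_le (mk_set_le _) (hμκ.le.trans (hA0.ge.trans (mk_set_le _)))))
  have hNκ : #N < κ := by
    rw [lift_inj.1 hNc]
    exact max_lt hN0 hμκ
  have hNne : Nonempty N := inferInstance
  obtain ⟨⟨e, he⟩⟩ : Nonempty (BlockVar ↪ θ) := by
    rw [← Cardinal.lift_mk_le', hθ]
    refine (lift_le.2 (mk_le_aleph0 (α := BlockVar))).trans ?_
    simp [theoryCard]
  -- Pads the countable tuple to a `θ`-tuple: variables outside the range of `e` repeat some block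
  -- variable, and the default value in `N` is `D`-almost never used.
  let G : (BlockVar → M) → θ → N := fun y t =>
    if h : y (Function.invFun e t) ∈ N then ⟨_, h⟩ else Classical.arbitrary N
  refine ⟨N, A1 ∪ A0, D.map G, hNκ, ?_, ?_⟩
  · refine le_antisymm ((mk_union_le _ _).trans (add_le_of_le hκ.aleph0_le ?_ hA0.le)) ?_
    · exact hA1c.trans (max_le hQc hκ.aleph0_le)
    · exact hA0.ge.trans (mk_le_mk_of_subset Set.subset_union_right)
  · rintro ⟨c, hc⟩
    refine hQo ⟨c ∘ e, fun S hS => ?_⟩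
    obtain ⟨χ, rfl⟩ := definable_iff_sat.1 ((hA1 S hS).mono (Set.subset_union_left (t := A0)))
    have key : ∀ c : θ → M, Sat (χ.relabel (Sum.map id e) : ParamFormula L (A1 ∪ A0 : Set M) θ) c ↔
        Sat χ (c ∘ e) := by
      intro c
      simp only [Sat, FirstOrder.Language.Formula.realize_relabel]
      refine iff_of_eq (congrArg χ.Realize (funext ?_))
      rintro (a | i) <;> rfl
    refine (key c).1 (hc _ ?_)
    refine (hDN.and (hQ _ hS).2).mono fun y hy => ?_
    refine (key _).2 ?_
    have : (fun t => (G y t : M)) ∘ e = y := by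
      funext i
      have h : y i ∈ N := hNs (hy.1 i)
      simp [G, Function.leftInverse_invFun he i, h]
    exact (iff_of_eq (congrArg (Sat χ) this)).2 hy.2

end Omitting

/-! ### Averages along an ultrafilter on a small set, and their Morley sequences. -/

section Coheir

variable {L : FirstOrder.Language.{u, v}} {M : Type w} [L.Structure M] {θ : Type x}
  {K : Type y} {e : K → θ → M} {D : Ultrafilter K} {N : Set M}

/-- A single `e k` would satisfy the instance at `b` and not the one at `c`; as `e k` lies in `N`,
it turns `φ` into a formula over `N` separating `b` from `c`. -/
theorem doesNotSplitOver_average (he : ∀ k i, e k i ∈ N) (B : Set M) :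
    DoesNotSplitOver (average L e (D : Filter K) B) N := by
  intro n φ b c hb hc htp
  obtain ⟨k, hk1, hk2⟩ := (Filter.Eventually.and hb hc).exists
  rw [sat_not] at hk2
  let φ' : ParamFormula L N (Fin n) := φ.relabel (Sum.elim Sum.inr fun i => Sum.inl ⟨e k i, he k i⟩)
  have key : ∀ d : Fin n → B, Sat φ' (fun i => (d i : M)) ↔ Sat (inst φ d) (e k) := by
    intro d
    simp only [Sat, φ', inst, FirstOrder.Language.Formula.realize_relabel]
    refine iff_of_eq (congrArg φ.Realize (funext ?_))
    rintro (i | i) <;> rfl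
  have h1 : φ' ∈ tp L N fun i => (b i : M) := (key b).2 hk1
  rw [htp] at h1
  exact hk2 ((key c).1 h1)

theorem restrict_average (F : Filter K) {A B : Set M} (h : A ⊆ B) :
    restrict h (average L e F B) = average L e F A := by
  ext φ
  refine Filter.eventually_congr (Filter.Eventually.of_forall fun k => ?_)
  simp only [Sat, FirstOrder.Language.Formula.realize_relabel]
  refine iff_of_eq (congrArg φ.Realize (funext ?_))
  rintro (a | i) <;> rfl

theorem Realizes.average_mono {F : Filter K} {A B : Set M} (h : A ⊆ B) {c : θ → M}
    (hc : Realizes (average L e F B) c) : Realizes (average L e F A) c := by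
  intro φ hφ
  rw [← restrict_average F h] at hφ
  have := hc _ hφ
  simp only [Sat, FirstOrder.Language.Formula.realize_relabel] at this
  refine (iff_of_eq (congrArg φ.Realize (funext ?_))).1 this
  rintro (a | i) <;> rfl

theorem realize_iff_eventually {B : Set M} {c : θ → M}
    (hc : Realizes (average L e (D : Filter K) B) c) {β : Type z} (χ : L.Formula (β ⊕ θ))
    {p : β → M} (hp : ∀ b, p b ∈ B) :
    χ.Realize (Sum.elim p c) ↔ ∀ᶠ k in (D : Filter K), χ.Realize (Sum.elim p (e k)) := by
  let χ' : ParamFormula L B θ := χ.relabel (Sum.map (fun b => ⟨p b, hp b⟩) id)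
  have key : ∀ d : θ → M, Sat χ' d ↔ χ.Realize (Sum.elim p d) := by
    intro d
    simp only [Sat, χ', FirstOrder.Language.Formula.realize_relabel]
    refine iff_of_eq (congrArg χ.Realize (funext ?_))
    rintro (i | i) <;> rfl
  simp only [← key]
  refine ⟨fun h => ?_, fun h => hc χ' h⟩
  by_contra hn
  have := hc χ'.not ((Ultrafilter.eventually_not.2 hn).mono fun k hk => (sat_not _ _).2 hk)
  exact (sat_not _ _).1 this h

variable {I : Type z} [LinearOrder I]

/-- The parameters available at stage `α` of a sequence over `N`. -/
def priorParams (N : Set M) (a : I → θ → M) (α : I) : Set M :=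
  N ∪ ⋃ β ∈ Set.Iio α, Set.range (a β)

variable (L) in
/-- A Morley sequence over `N` of the average of `e` along `D`. -/
def IsMorley (e : K → θ → M) (D : Ultrafilter K) (N : Set M) (a : I → θ → M) : Prop :=
  ∀ α, Realizes (average L e (D : Filter K) (priorParams N a α)) (a α)

/-- Induction on the number of terms: the last term can be replaced by `e k` for almost all `k`, and
since `e k` lies in `N` this leaves a formula over `N` about one term fewer. -/
theorem IsMorley.isIndiscernible {a : I → θ → M} (ha : IsMorley L e D N a)
    (he : ∀ k i, e k i ∈ N) : IsIndiscernible L N a := by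
  have key : ∀ (n : ℕ) (χ : L.Formula (N ⊕ (Fin n × θ))) (s t : Fin n → I), StrictMono s →
      StrictMono t → (Sat χ (fun j : Fin n × θ => a (s j.1) j.2) ↔
        Sat χ (fun j : Fin n × θ => a (t j.1) j.2)) := by
    intro n
    induction n with
    | zero =>
      intro χ s t _ _
      rw [Subsingleton.elim s t]
    | succ n ih =>
      intro χ s t hs ht
      let g : N ⊕ (Fin (n + 1) × θ) → (N ⊕ (Fin n × θ)) ⊕ θ := fun z => match z with
        | Sum.inl b => Sum.inl (Sum.inl b)
        | Sum.inr (j, i) => Fin.lastCases (motive := fun _ => (N ⊕ (Fin n × θ)) ⊕ θ) (Sum.inr i)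
            (fun j => Sum.inl (Sum.inr (j, i))) j
      let p : (Fin (n + 1) → I) → N ⊕ (Fin n × θ) → M := fun s =>
        Sum.elim (fun b : N => (b : M)) fun j => a (s j.1.castSucc) j.2
      have h1 : ∀ s : Fin (n + 1) → I, StrictMono s →
          (Sat χ (fun j : Fin (n + 1) × θ => a (s j.1) j.2) ↔
          ∀ᶠ k in (D : Filter K), (χ.relabel g).Realize (Sum.elim (p s) (e k))) := by
        intro s hs
        rw [← realize_iff_eventually (ha (s (Fin.last n)))]
        · rw [FirstOrder.Language.Formula.realize_relabel]
          refine iff_of_eq (congrArg χ.Realize (funext ?_))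
          rintro (b | ⟨j, i⟩)
          · rfl
          · refine Fin.lastCases ?_ (fun j => ?_) j <;> simp [g, p]
        · rintro (b | ⟨j, i⟩)
          · exact Or.inl b.2
          · exact Or.inr (Set.mem_biUnion (hs (Fin.castSucc_lt_last j)) ⟨i, rfl⟩)
      rw [h1 s hs, h1 t ht]
      refine Filter.eventually_congr (Filter.Eventually.of_forall fun k => ?_)
      have h2 : ∀ s : Fin (n + 1) → I, (χ.relabel g).Realize (Sum.elim (p s) (e k)) ↔
          Sat ((χ.relabel g).relabel (Sum.elim id fun i => Sum.inl ⟨e k i, he k i⟩) :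
            ParamFormula L N (Fin n × θ)) (fun j : Fin n × θ => a (s j.1.castSucc) j.2) := by
        intro s
        rw [Sat, FirstOrder.Language.Formula.realize_relabel (φ := χ.relabel g)]
        refine iff_of_eq (congrArg (χ.relabel g).Realize (funext ?_))
        rintro ((b | j) | i) <;> rfl
      rw [h2 s, h2 t]
      exact ih _ (s ∘ Fin.castSucc) (t ∘ Fin.castSucc) (hs.comp Fin.strictMono_castSucc)
        (ht.comp Fin.strictMono_castSucc)
  intro n s t hs ht
  ext χ
  exact key n χ s t hs ht

theorem IsMorley.average_eq [Nonempty I] [NoMaxOrder I] {a : I → θ → M}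
    (ha : IsMorley L e D N a) (hN : N.Nonempty) :
    average L a atTop (N ∪ ⋃ α, Set.range (a α)) =
      average L e (D : Filter K) (N ∪ ⋃ α, Set.range (a α)) := by
  classical
  have key : ∀ χ : ParamFormula L (N ∪ ⋃ α, Set.range (a α) : Set M) θ, ∀ᶠ α in atTop,
      (Sat χ (a α) ↔ ∀ᶠ k in (D : Filter K), Sat χ (e k)) := by
    intro χ
    obtain ⟨n0, hn0⟩ := hN
    obtain ⟨F, hF⟩ := exists_finset_realize_congr (M := M) χ
    have hev : ∀ᶠ α in (atTop : Filter I), ∀ b ∈ F.toLeft, (b : M) ∈ priorParams N a α := by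
      refine (Filter.eventually_all_finset _).2 fun b _ => ?_
      rcases b.2 with h | h
      · exact Filter.Eventually.of_forall fun α => Or.inl h
      · obtain ⟨β, hβ⟩ := Set.mem_iUnion.1 h
        exact (Filter.eventually_gt_atTop β).mono fun α hα => Or.inr (Set.mem_biUnion hα hβ)
    refine hev.mono fun α hα => ?_
    -- Parameters not occurring in `χ` are sent to `n0`, so that the whole assignment lies in the
    -- parameters prior to `α`.
    let p : (N ∪ ⋃ α, Set.range (a α) : Set M) → M := fun b =>
      if b ∈ F.toLeft then (b : M) else n0
    have hp : ∀ b, p b ∈ priorParams N a α := by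
      intro b
      by_cases hb : b ∈ F.toLeft
      · simpa only [p, if_pos hb] using hα b hb
      · simp only [p, if_neg hb]
        exact Or.inl hn0
    have h1 : ∀ c : θ → M, Sat χ c ↔ χ.Realize (Sum.elim p c) := by
      intro c
      refine hF _ _ ?_
      rintro (b | i) hb
      · have : b ∈ F.toLeft := by simpa using hb
        simp only [Sum.elim_inl, p, if_pos this]
      · rfl
    simp only [h1]
    exact realize_iff_eventually (ha α) χ hp
  ext χ
  constructor
  · intro h
    obtain ⟨α, h1, h2⟩ := ((key χ).and h).exists
    exact h1.1 h2
  · intro h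
    exact (key χ).mono fun α hα => hα.2 h

/-- The parameters of `χ` involve finitely many terms of the sequence; over these and `N`,
indiscernibility identifies `b` with any `a α` beyond them. -/
theorem realizes_average_of_isIndiscernible [Nonempty I] [NoMaxOrder I] {a : I → θ → M}
    (hN : N.Nonempty) {b : θ → M}
    (hb : IsIndiscernible L N
      (fun α : WithTop I => WithTop.recTopCoe (C := fun _ => θ → M) b a α)) :
    Realizes (average L a atTop (N ∪ ⋃ α, Set.range (a α))) b := by
  classical
  intro χ hχ
  obtain ⟨n0, hn0⟩ := hN
  obtain ⟨F, hF⟩ := exists_finset_realize_congr (M := M) χ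
  have hidx : ∀ p : (N ∪ ⋃ α, Set.range (a α) : Set M), ∃ β, (p : M) ∈ N ∨
      (p : M) ∈ Set.range (a β) := by
    rintro ⟨p, h | h⟩
    · exact ⟨Classical.arbitrary I, Or.inl h⟩
    · obtain ⟨β, hβ⟩ := Set.mem_iUnion.1 h
      exact ⟨β, Or.inr hβ⟩
  choose idx hidx using hidx
  let G : Finset I := F.toLeft.image idx
  obtain ⟨α, hα, hαG⟩ := (Filter.Eventually.and hχ
    ((Filter.eventually_all_finset G).2 fun β _ => Filter.eventually_gt_atTop β)).exists
  let a' : WithTop I → θ → M := fun α => WithTop.recTopCoe (C := fun _ => θ → M) b a α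
  let s0 : Fin G.card → I := G.orderEmbOfFin rfl
  let σ : WithTop I → Fin (G.card + 1) → WithTop I := fun d =>
    Fin.snoc (α := fun _ => WithTop I) (fun k => (s0 k : WithTop I)) d
  have hσ : ∀ d : WithTop I, (∀ β ∈ G, (β : WithTop I) < d) → StrictMono (σ d) := by
    intro d hd j k
    refine Fin.lastCases (fun h => absurd h (Fin.le_last _).not_gt) (fun j => ?_) j
    refine Fin.lastCases (fun _ => ?_) (fun k h => ?_) k
    · simpa [σ] using hd _ (G.orderEmbOfFin_mem rfl j)
    · simpa [σ, s0] using h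
  have hg : ∀ x : (N ∪ ⋃ α, Set.range (a α) : Set M) ⊕ θ, ∃ g : N ⊕ (Fin (G.card + 1) × θ),
      x ∈ F → ∀ d, Sum.elim (fun n : N => (n : M)) (fun j => a' (σ d j.1) j.2) g =
        Sum.elim (fun p : (N ∪ ⋃ α, Set.range (a α) : Set M) => (p : M)) (a' d) x := by
    rintro (p | i)
    · by_cases hp : p ∈ F.toLeft
      · rcases hidx p with h | ⟨i, h⟩
        · exact ⟨Sum.inl ⟨p, h⟩, fun _ _ => rfl⟩
        · obtain ⟨j, hj⟩ : idx p ∈ Set.range (G.orderEmbOfFin rfl) := by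
            rw [Finset.range_orderEmbOfFin]
            exact Finset.mem_image_of_mem _ hp
          refine ⟨Sum.inr (j.castSucc, i), fun _ d => ?_⟩
          simp [σ, s0, hj, a', h]
      · exact ⟨Sum.inl ⟨n0, hn0⟩, fun h => absurd (by simpa using h) hp⟩
    · exact ⟨Sum.inr (Fin.last _, i), fun _ d => by simp [σ]⟩
  choose g hg using hg
  have key : ∀ d, Sat χ (a' d) ↔
      χ.relabel g ∈ tp L N (fun j : Fin (G.card + 1) × θ => a' (σ d j.1) j.2) := by
    intro d
    simp only [tp, Set.mem_ofPred_eq, Sat, FirstOrder.Language.Formula.realize_relabel]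
    exact hF _ _ fun x hx => (hg x hx d).symm
  refine (key ⊤).2 ?_
  rw [hb _ (σ ⊤) (σ α) (hσ _ fun β _ => WithTop.coe_lt_top β)
    (hσ _ fun β hβ => WithTop.coe_lt_coe.2 (hαG β hβ))]
  exact (key α).1 hα

/-- Each pattern of truth values of `ψ` occurs along some increasing tuple of the sequence. By
indiscernibility, on one fixed tuple each pattern is produced by some other choice of the parameters
of `ψ`, so that tuple is shattered. -/
theorem IsIndiscernible.not_alternating [Nonempty I] [Nonempty M] {T : L.Theory} [M ⊨ T]
    (hT : IsDependent.{u, v, w} T) {a : I → θ → M} (ha : IsIndiscernible L N a) {A : Set M}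
    (ψ : ParamFormula L A θ) (h : ∀ (s : Bool) (α : I), ∃ β > α, Sat ψ (a β) ↔ s = true) :
    False := by
  classical
  choose next hnext hnext' using h
  have hseq : ∀ s : ℕ → Bool, ∃ t : ℕ → I, StrictMono t ∧ ∀ k, Sat ψ (a (t k)) ↔ s k = true := by
    intro s
    let i0 : I := Classical.arbitrary I
    let t : ℕ → I := fun k => Nat.rec (next (s 0) i0) (fun k i => next (s (k + 1)) i) k
    refine ⟨t, strictMono_nat_of_lt_succ fun k => hnext _ _, fun k => ?_⟩
    cases k <;> exact hnext' _ _
  obtain ⟨n, hn⟩ := hT.exists_not_shattered (M := M) ψ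
  obtain ⟨t0, ht0, -⟩ := hseq fun _ => true
  obtain ⟨s, hs⟩ := hn fun i => a (t0 i)
  obtain ⟨t, ht, hts⟩ := hseq fun k => if h : k < n then decide (⟨k, h⟩ ∈ s) else false
  let S : Set (Fin n × θ → M) := {f | ∃ y : A → M, Sum.elim f y ∈ ⋂ i ∈ (Set.univ : Set (Fin n)),
    {z : (Fin n × θ) ⊕ A → M |
      ψ.Realize (Sum.elim (z ∘ Sum.inr) fun j => z (Sum.inl (i, j))) ↔ i ∈ s}}
  have hS : N.Definable L S := by
    refine definable_exists (definable_biInter Set.finite_univ fun i _ => ?_)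
    have hi : N.Definable L {z : (Fin n × θ) ⊕ A → M |
        ψ.Realize (Sum.elim (z ∘ Sum.inr) fun j => z (Sum.inl (i, j)))} := by
      refine definable_of_realize ψ
        (Sum.elim (fun b => Sum.inr (Sum.inr b)) fun j => Sum.inr (Sum.inl (i, j))) fun z => ?_
      refine iff_of_eq (congrArg ψ.Realize (funext ?_))
      rintro (b | j) <;> rfl
    by_cases his : i ∈ s
    · simpa [his] using hi
    · simp only [his, iff_false]
      exact hi.compl
  obtain ⟨χ, hχ⟩ := definable_iff_sat.1 hS
  have h1 : (fun j : Fin n × θ => a (t j.1) j.2) ∈ S := by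
    refine ⟨fun b => b, ?_⟩
    simp only [Set.mem_iInter, Set.mem_ofPred_eq]
    intro i _
    have := hts i
    simp only [i.2, dif_pos, decide_eq_true_eq] at this
    exact this
  have h2 : χ ∈ tp L N (fun j : Fin n × θ => a (t j.1) j.2) := hχ.subset h1
  rw [ha n (fun i => t i) (fun i => t0 i) (fun i j hij => ht hij) (fun i j hij => ht0 hij)] at h2
  obtain ⟨y, hy⟩ := hχ.symm.subset h2
  simp only [Set.mem_iInter, Set.mem_ofPred_eq] at hy
  exact hs y fun i => hy i trivial

theorem mk_priorParams_lt {κ : Cardinal.{w}} (hκ : ℵ₀ ≤ κ) (hN : #N < κ)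
    (hθ : Cardinal.lift.{w} #θ < Cardinal.lift.{x} κ) (a : κ.ord.ToType → θ → M)
    (α : κ.ord.ToType) : #(priorParams N a α) < κ := by
  obtain ⟨μ, hμ⟩ := mem_range_lift_of_le hθ.le
  have hμκ : μ < κ := by rwa [← hμ, lift_lt] at hθ
  refine (mk_union_le _ _).trans_lt (add_lt_of_lt hκ hN ((mk_biUnion_le _ _).trans_lt ?_))
  refine mul_lt_of_lt hκ (by simpa using mk_Iio_lt α) ((ciSup_le' fun β => ?_).trans_lt hμκ)
  rw [← Cardinal.lift_le.{x}, hμ]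
  exact mk_range_le_lift

/-- An enumeration in order type `κ` in which every element occurs cofinally often. -/
theorem exists_cofinal_enumeration {κ : Cardinal.{w}} (hκ : ℵ₀ ≤ κ) {P : Type z} [Nonempty P]
    (hP : Cardinal.lift.{w} #P ≤ Cardinal.lift.{z} κ) :
    ∃ g : κ.ord.ToType → P, ∀ p α, ∃ β > α, g β = p := by
  have hcard : Cardinal.lift.{w} #(P × κ.ord.ToType) ≤ Cardinal.lift.{max w z} #κ.ord.ToType := by
    rw [mk_prod, mk_ord_toType]
    refine (lift_le.2 (mul_le_of_le (aleph0_le_lift.2 hκ) hP le_rfl)).trans ?_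
    rw [lift_lift]
  obtain ⟨f⟩ := Cardinal.lift_mk_le'.1 hcard
  have hne : Nonempty κ.ord.ToType := by
    rw [← Cardinal.mk_ne_zero_iff, mk_ord_toType]
    exact (aleph0_pos.trans_le hκ).ne'
  -- With `f` an injection of `P × κ` into `κ`, every `p` occurs at `κ` many places, whereas a
  -- proper initial segment has fewer than `κ` elements.
  refine ⟨fun β => (Function.invFun f β).1, fun p α => ?_⟩
  by_contra! hno
  have hle : ∀ γ, f (p, γ) ≤ α := by
    intro γ
    by_contra! hlt
    exact hno _ hlt (by rw [Function.leftInverse_invFun f.injective])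
  have h1 : #κ.ord.ToType ≤ #(Set.Iic α) :=
    mk_le_of_injective (f := fun γ => ⟨f (p, γ), hle γ⟩) fun γ γ' h => by
      simpa using f.injective (Subtype.ext_iff.1 h)
  have h2 : #(Set.Iic α) < κ := by
    rw [← Set.Iio_union_right]
    refine (mk_union_le _ _).trans_lt (add_lt_of_lt hκ ?_ ?_)
    · simpa using mk_Iio_lt α
    · rw [mk_singleton]
      exact one_lt_aleph0.trans_le hκ
  rw [mk_ord_toType] at h1
  exact h1.not_gt h2

theorem exists_realizes_average_sat [Nonempty M] {κ : Cardinal.{w}} (hκ : ℵ₀ ≤ κ)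
    (hM : IsSaturated L M κ) (hθ : Cardinal.lift.{w} #θ < Cardinal.lift.{x} κ) {B A : Set M}
    (hB : #B < κ) {ψ : ParamFormula L A θ} (hψ : ψ ∈ average L e (D : Filter K) A) :
    ∃ c, Realizes (average L e (D : Filter K) B) c ∧ Sat ψ c := by
  obtain ⟨A0, -, hA0⟩ := Set.definable_iff_finitely_definable.1 (definable_sat ψ)
  have hBc : #(B ∪ A0 : Set M) < κ := (mk_union_le _ _).trans_lt
    (add_lt_of_lt hκ hB ((Cardinal.lt_aleph0_of_finite _).trans_le hκ))
  obtain ⟨χ, hχ⟩ := definable_iff_sat.1 (hA0.mono (Set.subset_union_right (s := B)))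
  obtain ⟨c, hc⟩ := hM.exists_sat hκ hBc hθ ((D : Filter K).map e)
  have hc' : Realizes (average L e (D : Filter K) (B ∪ A0 : Set M)) c := fun φ hφ => hc φ hφ
  exact ⟨c, hc'.average_mono Set.subset_union_left,
    hχ.symm.subset (hc' χ (hψ.mono fun k hk => hχ.subset hk))⟩

/-- A Morley sequence of length `κ` such that the restriction of the average to the sequence
implies its restriction to `A`. -/
theorem exists_isMorley_omits [Nonempty M] {T : L.Theory} [M ⊨ T]
    (hT : IsDependent.{u, v, w} T) {κ : Cardinal.{w}} (hκ : ℵ₀ ≤ κ) (hM : IsSaturated L M κ)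
    (hθ : Cardinal.lift.{w} #θ < Cardinal.lift.{x} κ) (hN : #N < κ) (he : ∀ k i, e k i ∈ N)
    {A : Set M} (hA : Cardinal.lift.{w} #(ParamFormula L A θ) ≤
      Cardinal.lift.{max u v w x} κ)
    (hom : Omits (average L e (D : Filter K) A)) :
    ∃ a : κ.ord.ToType → θ → M, IsMorley L e D N a ∧
      Omits (average L e (D : Filter K) (N ∪ ⋃ α, Set.range (a α))) := by
  classical
  have hne : Nonempty κ.ord.ToType := by
    rw [← Cardinal.mk_ne_zero_iff, mk_ord_toType]
    exact (aleph0_pos.trans_le hκ).ne'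
  have : Nonempty (ParamFormula L A θ × Bool) := ⟨(⊤, true)⟩
  obtain ⟨g, hg⟩ := exists_cofinal_enumeration hκ (P := ParamFormula L A θ × Bool) (by
    rw [mk_prod, lift_mul, lift_lift]
    exact mul_le_of_le (aleph0_le_lift.2 hκ) hA
      ((by simp : _ ≤ ℵ₀).trans (aleph0_le_lift.2 hκ)))
  -- Term `α` realizes the average over the prior parameters and, if this is possible, gives the
  -- formula listed at `α` the listed truth value.
  obtain ⟨a, ha⟩ := exists_forall_rel_of_wellFounded
    (fun (α : κ.ord.ToType) (a : κ.ord.ToType → θ → M) (m : θ → M) =>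
      Realizes (average L e (D : Filter K) (priorParams N a α)) m ∧
      ((∃ c, Realizes (average L e (D : Filter K) (priorParams N a α)) c ∧
        (Sat (g α).1 c ↔ (g α).2 = true)) → (Sat (g α).1 m ↔ (g α).2 = true)))
    (by
      intro α a a' m h hm
      have : priorParams N a' α = priorParams N a α := by
        simp only [priorParams]
        congr 1
        exact Set.iUnion₂_congr fun β hβ => by rw [h β hβ]
      rwa [this])
    (by
      intro α a _
      by_cases h : ∃ c, Realizes (average L e (D : Filter K) (priorParams N a α)) c ∧
        (Sat (g α).1 c ↔ (g α).2 = true)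
      · obtain ⟨c, hc1, hc2⟩ := h
        exact ⟨c, hc1, fun _ => hc2⟩
      · obtain ⟨c, hc⟩ := hM.exists_sat hκ (mk_priorParams_lt hκ hN hθ a α) hθ
          ((D : Filter K).map e)
        exact ⟨c, fun φ hφ => hc φ hφ, fun h' => absurd h' h⟩)
  have hMor : IsMorley L e D N a := fun α => (ha α).1
  refine ⟨a, hMor, ?_⟩
  rintro ⟨c, hc⟩
  refine hom ⟨c, fun ψ hψ => ?_⟩
  by_contra hcψ
  -- Both truth values of `ψ` are available at every stage: `c` itself witnesses falsity, and
  -- saturation supplies a realization satisfying `ψ`, as `ψ` belongs to the average.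
  refine (hMor.isIndiscernible he).not_alternating hT ψ fun s α => ?_
  obtain ⟨β, hβα, hβ⟩ := hg (ψ, s) α
  refine ⟨β, hβα, ?_⟩
  have h1 := (ha β).2
  rw [hβ] at h1
  refine h1 ?_
  cases s
  · refine ⟨c, hc.average_mono ?_, by simpa using hcψ⟩
    exact Set.union_subset_union_right _ (Set.iUnion₂_subset fun γ _ =>
      Set.subset_iUnion (fun γ => Set.range (a γ)) γ)
  · obtain ⟨d, hd1, hd2⟩ := exists_realizes_average_sat hκ hM hθ
      (mk_priorParams_lt hκ hN hθ a β) hψ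
    exact ⟨d, hd1, by simpa using hd2⟩

end Coheir

end SingularExactSaturation

/-! ### Assembly of the theorem. -/

theorem lemma2 {L : FirstOrder.Language.{u, v}} (T : L.Theory) (hT : T.IsComplete)
    (hdep : IsDependent.{u, v, w} T)
    {M : Type w} [L.Structure M] [Nonempty M] [M ⊨ T]
    (κ : Cardinal.{w}) (hκ : κ.IsSingular)
    (hcof : Cardinal.lift.{w} (theoryCard L) < Cardinal.lift.{max u v} κ.ord.cof)
    (hM : IsExactlySaturated L M κ)
    (θ : Type (max u v)) (hθ : #θ = theoryCard L) :
    ∃ (N : L.ElementarySubstructure M) (A : Set M),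
      #N < κ ∧ #A = κ ∧
      (∃ p ∈ completeTypes L A θ,
        Omits p ∧ DoesNotSplitOver p (N : Set M) ∧
        (∃ q ∈ completeTypes L (Set.univ : Set M) θ,
          DoesNotSplitOver q (N : Set M) ∧ p = restrict (Set.subset_univ A) q) ∧
        ∃ D : Ultrafilter (θ → N),
          p = average L (fun (c : θ → N) (i : θ) => (c i : M)) (D : Filter (θ → N)) A) ∧
      ∃ a : κ.ord.ToType → θ → M,
        IsIndiscernible L (N : Set M) a ∧
        average L a atTop ((N : Set M) ∪ ⋃ α, Set.range (a α)) ∈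
          completeTypes L ((N : Set M) ∪ ⋃ α, Set.range (a α)) θ ∧
        Omits (average L a atTop ((N : Set M) ∪ ⋃ α, Set.range (a α))) ∧
        ∀ b : θ → M, ¬ IsIndiscernible L (N : Set M)
          (fun α : WithTop κ.ord.ToType => WithTop.recTopCoe (C := fun _ => θ → M) b a α) := by
  have hL : Cardinal.lift.{w} (theoryCard L) < Cardinal.lift.{max u v} κ :=
    hcof.trans (lift_lt.2 hκ.cof_ord_lt)
  have hθκ : Cardinal.lift.{w} #θ < Cardinal.lift.{max u v} κ := by rwa [hθ]
  obtain ⟨N, A, D, hN, hA, hom⟩ := exists_omitted_coheir hdep hκ hcof hM θ hθ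
  have he : ∀ (c : θ → N) (i : θ), (c i : M) ∈ (N : Set M) := fun c i => (c i).2
  have hNne : (N : Set M).Nonempty := ⟨_, (Classical.arbitrary N).2⟩
  obtain ⟨a, hMor, homa⟩ := exists_isMorley_omits hdep hκ.aleph0_le hM.1 hθκ hN he
    (lift_mk_formula_le hκ.aleph0_le hL.le (by
      rw [mk_sum, hA, lift_add, lift_lift, lift_lift]
      exact add_le_of_le (aleph0_le_lift.2 hκ.aleph0_le) (by simp) (by
        rw [Cardinal.lift_umax.{w, max u v}]
        exact hθκ.le))) hom
  have hne : Nonempty κ.ord.ToType := by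
    rw [← Cardinal.mk_ne_zero_iff, mk_ord_toType]
    exact hκ.pos.ne'
  have hmax : NoMaxOrder κ.ord.ToType := Cardinal.noMaxOrder hκ.aleph0_le
  have hav := hMor.average_eq hNne
  -- The same `D` yields `p` as its average over `A`, `q` as its average over all of `M`, and the
  -- average of the Morley sequence over `B`.
  refine ⟨N, A, hN, hA, ⟨_, average_mem_completeTypes _ D A, hom,
    doesNotSplitOver_average he A, ⟨_, average_mem_completeTypes _ D Set.univ,
      doesNotSplitOver_average he _, (restrict_average _ _).symm⟩, D, rfl⟩,
    a, hMor.isIndiscernible he, ?_, ?_, ?_⟩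
  · rw [hav]
    exact average_mem_completeTypes _ D _
  · rwa [hav]
  · intro b hb
    rw [← hav] at homa
    exact homa ⟨b, realizes_average_of_isIndiscernible hNne hb⟩
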